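/- **Setting.** Let $p\ge 1$ be an integer, $\mathcal Z\subseteq\mathbb R^d$ closed and convex, $\mu,L_p,\epsilon>0$, and let $h$ be a real function that is $p$ times continuously differentiable around every point of $\mathcal Z$, such that $$\|\nabla^p h(z)-\nabla^p h(z')\|\le L_p\|z-z'\|,\qquad h(z)\ge h(z')+\langle\nabla h(z'),z-z'\rangle+\frac{\mu}{p+1}\|z-z'\|^{p+1}\qquad(z,z'\in\mathcal Z).$$ Let $z^*$ be the minimizer of $h$ over $\mathcal Z$, $z^{(0)}\in\mathcal Z$ and $\Delta=h(z^{(0)})-h(z^*)$. A call of the $p$th-order oracle at $x$ returns $h(x),\nabla h(x),\dots,\nabla^p h(x)$. **Tensor step.** A $p$th-order tensor step from $\bar z\in\mathcal Z$ is any point $\tilde z\in\mathcal Z$ with $\langle m_{\bar z}(\tilde z),z'-\tilde z\rangle\ge 0$ for all $z'\in\mathcal Z$, where $$m_{\bar z}(z)=\sum_{k=0}^{p-1}\frac1{k!}\nabla^k(\nabla h)(\bar z)[z-\bar z]^k+\frac{2L_p}{p!}\|z-\bar z\|^{p-1}(z-\bar z);$$ with it comes the vector $u=-m_{\bar z}(\tilde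 z)$ of the normal cone of $\mathcal Z$ at $\tilde z$. **Algorithm (OptMS-restart), parameter $\gamma=L_p$.** There are $S$ epochs of $T$ iterations. Epoch $s$ starts with $v_0=z_0=\tilde z_0=z^{(s)}$, $A_0=0$, $\lambda_1'=1$. Iteration $t=0,\dots,T-1$ of the epoch is as follows. 1. Let $a'_{t+1}>0$ solve $A_t+a'_{t+1}=2\lambda'_{t+1}(a'_{t+1})^2$, put $A'_{t+1}=A_t+a'_{t+1}$ and $\bar z_t=\frac{A_t}{A'_{t+1}}z_t+\frac{a'_{t+1}}{A'_{t+1}}v_t$. 2. Let $(\tilde z_{t+1},u_{t+1})$ be given by a tensor step from $\bar z_t$, and $\lambda_{t+1}=\gamma\|\tilde z_{t+1}-\bar z_t\|^{p-1}$ (with $0^0=1$). 3. If $t=0$, replace $\lambda_1'$ by $\lambda_1$ and solve for $a_1'$ and $A_1'$ again with this value (which leaves $\bar z_0=z^{(s)}$ unchanged). If $\lambda'_1=0$, then $\tilde z_1=\bar z_0$ is the minimizer, and the epoch stops with $z_1=\tilde z_1$. 4. If $\lambda_{t+1}\le\lambda'_{t+1}$, put $\gamma_{t+1}=1$ and $\lambda'_{t+2}=\frac12\lambda'_{t+1}$;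 otherwise put $\gamma_{t+1}=\lambda'_{t+1}/\lambda_{t+1}$ and $\lambda'_{t+2}=2\lambda'_{t+1}$. In both cases $a_{t+1}=\gamma_{t+1}a'_{t+1}$, $A_{t+1}=A_t+a_{t+1}$. 5. Put $z_{t+1}=\frac{(1-\gamma_{t+1})A_t}{A_{t+1}}z_t+\frac{\gamma_{t+1}A'_{t+1}}{A_{t+1}}\tilde z_{t+1}$ and $v_{t+1}=\mathrm{Proj}_{\mathcal Z}\big(v_t-a_{t+1}(\nabla h(\tilde z_{t+1})+u_{t+1})\big)$. The epoch returns as $z^{(s+1)}$ the point with the lowest value of $h$ among the points $z_t,\tilde z_t$, $0\le t\le T$, that were computed. The oracle is called for the values $h(z_t),h(\tilde z_t)$, for each tensor step, and for each gradient $\nabla h(\tilde z_{t+1})$. **Theorem (OptMS-restart).** There are constants $c,C>0$ that depend only on $p$ such that, for all data as above, with $$T=\Big\lceil c\,(L_p/\mu)^{2/(3p+1)}\Big\rceil,\qquad S=\max\{0,\lceil\log_2(\Delta/\epsilon)\rceil\}\quad(S=0\text{ if }\Delta=0),$$ the algorithm can be run (all its steps are solvable), and every run of it returns a point $z^{(S)}\in\mathcal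 Z$ with $h(z^{(S)})-h(z^*)\le\epsilon$ after at most $$C\,\max\{1,(L_p/\mu)^{2/(3p+1)}\}\,\max\{1,\log(\Delta/\epsilon)\}$$ calls of the $p$th-order oracle (where the last factor is $1$ if $\Delta=0$); that is, $\mathcal O\big((L_p/\mu)^{2/(3p+1)}\log(\Delta/\epsilon)\big)$ calls if $L_p\ge\mu$ and $\Delta\ge 2\epsilon$. -/

import Mathlib

open scoped Nat Gradient RealInnerProductSpace

noncomputable section

variable {E : Type*} [NormedAddCommGroup E] [InnerProductSpace ℝ E] [CompleteSpace E]

/-- `h` is `q`-th-order `μ`-uniformly convex on `Z`. -/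
def UniformlyConvex (q : ℕ) (μ : ℝ) (Z : Set E) (h : E → ℝ) : Prop :=
  ∀ z ∈ Z, ∀ z' ∈ Z, h z' + ⟪∇ h z', z - z'⟫ + μ / q * ‖z - z'‖ ^ q ≤ h z

/-- `h` is `p` times continuously differentiable around every point of `Z`, and its `p`-th
derivative is `L`-Lipschitz on `Z` (for the operator norm of `p`-linear forms). -/
def LipschitzDerivOn (p : ℕ) (L : ℝ) (Z : Set E) (h : E → ℝ) : Prop :=
  (∀ z ∈ Z, ContDiffAt ℝ p h z) ∧
  ∀ z ∈ Z, ∀ z' ∈ Z, ‖iteratedFDeriv ℝ p h z - iteratedFDeriv ℝ p h z'‖ ≤ L * ‖z - z'‖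

/-- The Taylor polynomial of degree `p - 1` of the operator `F` at `zbar`, evaluated at `z`:
`∑_{k < p} (1 / k!) ∇^k F(zbar)[z - zbar]^k`. -/
def taylorField (p : ℕ) (F : E → E) (zbar z : E) : E :=
  ∑ k ∈ Finset.range p, ((k ! : ℝ)⁻¹) • iteratedFDeriv ℝ k F zbar (fun _ => z - zbar)

/-- The regularized model `F̄_{p-1}(z; zbar) + (M / p!) ‖z - zbar‖^(p-1) (z - zbar)`. -/
def regularizedModel (p : ℕ) (F : E → E) (M : ℝ) (zbar z : E) : E :=
  taylorField p F zbar z + (M / (p ! : ℝ) * ‖z - zbar‖ ^ (p - 1)) • (z - zbar)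

/-- `z` is an output of the `p`-th-order tensor step from `zbar` for the operator `F` with
regularization `M` over `Z`: it solves the variational inequality of the regularized model. -/
def IsTensorStep (p : ℕ) (F : E → E) (M : ℝ) (Z : Set E) (zbar z : E) : Prop :=
  z ∈ Z ∧ ∀ z' ∈ Z, 0 ≤ ⟪regularizedModel p F M zbar z, z' - z⟫

/-- `w` is the Euclidean projection of `x` to `Z`. -/
def IsProj (Z : Set E) (x w : E) : Prop :=
  w ∈ Z ∧ ∀ y ∈ Z, ‖x - w‖ ≤ ‖x - y‖

/-- The proximal oracle implemented by a tensor step with regularization `M`: it returns the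
tensor step `zt` from `zbar` together with the vector `u` that the variational inequality puts
into the normal cone of `Z` at `zt`. -/
def IsTensorProx (p : ℕ) (M : ℝ) (Z : Set E) (h : E → ℝ) (zbar zt u : E) : Prop :=
  IsTensorStep p (∇ h) M Z zbar zt ∧ u = -regularizedModel p (∇ h) M zbar zt

/-- The variables of an epoch at the beginning of iteration `t`: the points `z_t`, `v_t`, `z̃_t`,
the numbers `A_t` and `λ'_{t+1}`, and the list of the points at which the `p`-th-order oracle
`x ↦ (h x, ∇h x, …, ∇^p h x)` has been called so far (a point called twice is listed twice). -/
structure IterState (E : Type*) where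
  z : E
  v : E
  zt : E
  A : ℝ
  lam' : ℝ
  queries : List E

/-- The state at the start of an epoch from `z`. There is no `z̃_0`; it is set to `z`. -/
def IterState.init (z : E) : IterState E :=
  { z := z, v := z, zt := z, A := 0, lam' := 1, queries := [] }

/-- Iteration `t` of an epoch, with exact oracles, `iProx` implemented by the tensor step with
regularization `M`, and parameter `γ`.

In iteration `0` the guess `λ'_1` is replaced by `λ_1`, and `a'_1` is solved for again with this
value; in the other iterations `lam'` is unchanged and `a'` is the number `a₀` found before.
If `λ'_1` becomes `0`, the equation for `a'_1` has no positive solution. Then `z̃_1 = z̄_0`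
is a minimizer of `h` over `Z`, and the epoch halts: `lam' = 0` marks a halted state. -/
def IsIteration (p : ℕ) (M γ : ℝ) (Z : Set E) (h : E → ℝ) (t : ℕ) (s s' : IterState E) : Prop :=
  if s.lam' = 0 then s' = s else
  ∃ (a₀ : ℝ) (zbar zt u : E),
    0 < a₀ ∧ s.A + a₀ = 2 * s.lam' * a₀ ^ 2 ∧
    zbar = (s.A / (s.A + a₀)) • s.z + (a₀ / (s.A + a₀)) • s.v ∧
    IsTensorProx p M Z h zbar zt u ∧
    let lam : ℝ := γ * ‖zt - zbar‖ ^ (p - 1)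
    let lam' : ℝ := if t = 0 then lam else s.lam'
    if lam' = 0 then
      s' = { z := zt, v := s.v, zt := zt, A := s.A, lam' := 0,
             queries := s.queries ++ [s.z, s.zt, zbar] }
    else
      ∃ (a' : ℝ) (v' : E),
        0 < a' ∧ s.A + a' = 2 * lam' * a' ^ 2 ∧
        let gam : ℝ := if lam ≤ lam' then 1 else lam' / lam
        let a : ℝ := gam * a'
        let A' : ℝ := s.A + a'
        let A : ℝ := s.A + a
        IsProj Z (s.v - a • (∇ h zt + u)) v' ∧
        s' = { z := ((1 - gam) * s.A / A) • s.z + (gam * A' / A) • zt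
               v := v'
               zt := zt
               A := A
               lam' := if lam ≤ lam' then lam' / 2 else 2 * lam'
               queries := s.queries ++ [s.z, s.zt, zbar, zt] }

/-- An epoch of `T` iterations started at `z`, which returns `zout`, a point with the lowest
value of `h` among `z_t`, `z̃_t`, `0 ≤ t ≤ T`, and calls the oracle at the points `queries`
(the last two calls give the values of `h` at `z_T` and `z̃_T`). -/
def IsEpoch (p : ℕ) (M γ : ℝ) (Z : Set E) (h : E → ℝ) (T : ℕ) (z zout : E)
    (queries : List E) : Prop :=
  ∃ st : ℕ → IterState E,
    st 0 = IterState.init z ∧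
    (∀ t < T, IsIteration p M γ Z h t (st t) (st (t + 1))) ∧
    (∃ i ≤ T, ∃ j ≤ T,
      (∀ t ≤ T, h (st i).z ≤ h (st t).z) ∧
      (∀ t ≤ T, h (st j).zt ≤ h (st t).zt) ∧
      zout = if h (st i).z < h (st j).zt then (st i).z else (st j).zt) ∧
    queries = (st T).queries ++ [(st T).z, (st T).zt]

/-- A run of the restarted method: `S` epochs of `T` iterations each, the first one from `z0`,
each later one from the point returned by the epoch before. `zout` is the point returned at the
end, `N` the total number of oracle calls. -/
def IsRestartRun (p : ℕ) (M γ : ℝ) (Z : Set E) (h : E → ℝ) (T S : ℕ) (z0 zout : E)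
    (N : ℕ) : Prop :=
  ∃ (zs : ℕ → E) (qs : ℕ → List E),
    zs 0 = z0 ∧
    (∀ s < S, IsEpoch p M γ Z h T (zs s) (zs (s + 1)) (qs s)) ∧
    zout = zs S ∧
    N = ∑ s ∈ Finset.range S, (qs s).length

end

/-! Write `R` for the distance from the starting point of an epoch to the minimizer, `r` for the
length of a tensor step, and `g` for the sum of the gradient and the normal vector at its output.
Since the regularization is `2 L`, the Taylor error is half the size of the regularizing term, so
`g` lies within `κ r` of `-2 κ (zt - zbar)`, where `κ = L r ^ (p - 1) / p!`. This makes the energy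
`A (h z - h z*) + ‖v - z*‖² / 2` nonincreasing, with a loss proportional to `γ_{t+1} A' κ r²`
(`energy_step`).

It remains to show that `A` grows fast although `λ'` is only a guess. With `b = 2 / (3p + 1)` and
suitable normalizations `Y` of `A` and `lam` of `λ'`, the balanced guess is `lam * Y ^ (1 - 2b) =
4`. A halving that starts from a guess too large, or a doubling from one too small, moves the
logarithm of the guess one unit towards balance. A halving at a guess that is not too large raises
`Y ^ b` by at least `b / 3`; a doubling at a guess that is not too small means a long tensor step
and costs energy of order `Y ^ (-b)`. Since the total energy is bounded, summing this potential
argument (`abs_logb_balance_step`) over `n` iterations gives `n = O(Y ^ b)`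
(`succ_le_mul_rpow_of_halving_doubling`, `weight_growth`).

The energy bounds the final gap by `R² / (2 A)`, and uniform convexity bounds `R ^ (p + 1)` by `(p +
1) / μ` times the initial gap. An epoch long enough for `R ^ (p - 1) * A ≥ (p + 1) / μ` therefore
halves the gap, and the required length does not depend on `R` (`IsEpoch.sub_le_half`). Solvability
reduces to the tensor step, which is obtained by minimizing a coercive potential of the model
(`exists_isTensorStep`). -/

/-! ### Taylor remainders and symmetry of iterated derivatives. -/

section Taylor

variable {E F : Type*} [NormedAddCommGroup E] [NormedSpace ℝ E]
  [NormedAddCommGroup F] [NormedSpace ℝ F]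

/-- Taylor's inequality on `[0, 1]` for a curve whose last derivative grows at most linearly. -/
theorem norm_sub_taylor_le_of_norm_sub_le {K : ℝ} (m : ℕ) (g : ℕ → ℝ → F)
    (hg : ∀ i < m, ∀ s ∈ Set.Icc (0 : ℝ) 1, HasDerivAt (g i) (g (i + 1) s) s)
    (hK : ∀ s ∈ Set.Icc (0 : ℝ) 1, ‖g m s - g m 0‖ ≤ K * s) :
    ∀ s ∈ Set.Icc (0 : ℝ) 1,
      ‖g 0 s - ∑ i ∈ Finset.range (m + 1), ((i ! : ℝ)⁻¹ * s ^ i) • g i 0‖ ≤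
        K * s ^ (m + 1) / ((m + 1)! : ℝ) := by
  induction m generalizing g with
  | zero => simpa using hK
  | succ m ih =>
    -- The derivative of the remainder is the remainder, one order lower, of the shifted family.
    have ih' := ih (fun i => g (i + 1)) (fun i hi => hg (i + 1) (by omega)) hK
    have hderiv : ∀ s ∈ Set.Icc (0 : ℝ) 1,
        HasDerivAt (fun s => g 0 s - ∑ i ∈ Finset.range (m + 1 + 1), ((i ! : ℝ)⁻¹ * s ^ i) • g i 0)
          (g 1 s - ∑ i ∈ Finset.range (m + 1), ((i ! : ℝ)⁻¹ * s ^ i) • g (i + 1) 0) s := by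
      intro s hs
      refine (hg 0 (by omega) s hs).sub ?_
      simp only [Finset.sum_range_succ' _ (m + 1)]
      simp only [Nat.factorial_zero, Nat.cast_one, inv_one, pow_zero, one_mul]
      refine HasDerivAt.add_const _ ?_
      refine HasDerivAt.fun_sum fun i _ => ?_
      refine HasDerivAt.smul_const ?_ _
      have h1 := (hasDerivAt_pow (i + 1) s).const_mul ((((i + 1)! : ℕ) : ℝ)⁻¹)
      refine h1.congr_deriv ?_
      have h2 : ((i ! : ℕ) : ℝ) ≠ 0 := by positivity
      rw [Nat.factorial_succ]
      push_cast
      field_simp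
    refine image_norm_le_of_norm_deriv_right_le_deriv_boundary
      (f' := fun s => g 1 s - ∑ i ∈ Finset.range (m + 1), ((i ! : ℝ)⁻¹ * s ^ i) • g (i + 1) 0)
      (B' := fun s => K * s ^ (m + 1) / ((m + 1)! : ℝ))
      (fun s hs => (hderiv s hs).continuousAt.continuousWithinAt)
      (fun s hs => (hderiv s ⟨hs.1, hs.2.le⟩).hasDerivWithinAt) ?_ (fun s => ?_)
      (fun s hs => ih' s ⟨hs.1, hs.2.le⟩)
    · simp [Finset.sum_range_succ' _ (m + 1)]
    · have h1 := ((hasDerivAt_pow (m + 1 + 1) s).const_mul K).div_const ((m + 1 + 1)! : ℝ)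
      refine h1.congr_deriv ?_
      have h2 : ((((m + 1)! : ℕ)) : ℝ) ≠ 0 := by positivity
      rw [Nat.factorial_succ (m + 1)]
      push_cast
      field_simp

/-- The derivative along a line of a diagonal value of an iterated derivative. -/
theorem hasDerivAt_iteratedFDeriv_add_smul {f : E → F} {x w : E} {i : ℕ} {s : ℝ}
    (hf : ContDiffAt ℝ (i + 1) f (x + s • w)) :
    HasDerivAt (fun s : ℝ => iteratedFDeriv ℝ i f (x + s • w) (fun _ => w))
      (iteratedFDeriv ℝ (i + 1) f (x + s • w) (fun _ => w)) s := by
  have hd : DifferentiableAt ℝ (iteratedFDeriv ℝ i f) (x + s • w) :=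
    hf.differentiableAt_iteratedFDeriv (by exact_mod_cast Nat.lt_succ_self i)
  have hline : HasDerivAt (fun s : ℝ => x + s • w) w s := by
    simpa using ((hasDerivAt_id s).smul_const w).const_add x
  have h := hd.hasFDerivAt.comp_hasDerivAt s hline
  have h2 := ((ContinuousMultilinearMap.apply ℝ (fun _ : Fin i => E) F
    (fun _ => w)).hasFDerivAt).comp_hasDerivAt s h
  exact h2

/-- Exchanging the first two arguments of an iterated derivative. -/
theorem iteratedFDeriv_update_zero_eq_update_one {n : ℕ} {f : E → F} {x : E}
    (hf : ContDiffAt ℝ (n + 2) f x) (w y : E) :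
    iteratedFDeriv ℝ (n + 2) f x (Function.update (fun _ => w) 0 y) =
      iteratedFDeriv ℝ (n + 2) f x (Function.update (fun _ => w) 1 y) := by
  have hn : ContDiffAt ℝ 2 (iteratedFDeriv ℝ n f) x :=
    hf.iteratedFDeriv_right (by rw [add_comm])
  have hsymm : IsSymmSndFDerivAt ℝ (iteratedFDeriv ℝ n f) x := hn.isSymmSndFDerivAt (by simp)
  have key : ∀ m : Fin (n + 2) → E, iteratedFDeriv ℝ (n + 2) f x m =
      fderiv ℝ (fderiv ℝ (iteratedFDeriv ℝ n f)) x (m 0) (m 1) (Fin.tail (Fin.tail m)) := by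
    intro m
    have hd : DifferentiableAt ℝ (iteratedFDeriv ℝ (n + 1) f) x :=
      hf.differentiableAt_iteratedFDeriv (by exact_mod_cast Nat.lt_succ_self (n + 1))
    have hd2 : DifferentiableAt ℝ (fderiv ℝ (iteratedFDeriv ℝ n f)) x :=
      (hn.fderiv_right (m := 1) (by rw [one_add_one_eq_two])).differentiableAt one_ne_zero
    have h1 : DifferentiableAt ℝ (fun y => fderiv ℝ (iteratedFDeriv ℝ n f) y (m 1)) x :=
      hd2.clm_apply (differentiableAt_const _)
    have h2 := fderiv_continuousMultilinear_apply_const h1 (Fin.tail (Fin.tail m))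
    have h3 := fderiv_clm_apply hd2 (differentiableAt_const (m 1))
    rw [hd.iteratedFDeriv_succ_apply_left']
    refine (congrArg (fun T => T (m 0)) h2).trans ?_
    rw [h3]
    simp
  rw [key, key, hsymm.eq]
  have ht : ∀ i : Fin (n + 2), (i = 0 ∨ i = 1) →
      Fin.tail (Fin.tail (Function.update (fun _ : Fin (n + 2) => w) i y)) = fun _ => w := by
    rintro i hi
    funext j
    have : j.succ.succ ≠ i := by
      rcases hi with rfl | rfl
      · exact Fin.succ_ne_zero _
      · exact fun h => Fin.succ_ne_zero j (Fin.succ_injective _ h)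
    simp [Fin.tail, Function.update_of_ne this]
  rw [ht 0 (Or.inl rfl), ht 1 (Or.inr rfl)]
  simp

/-- An iterated derivative at a tuple with all entries but one equal does not depend on the place
of the exceptional entry. -/
theorem iteratedFDeriv_update_eq_update_zero {n : ℕ} {f : E → F} {x : E}
    (hf : ContDiffAt ℝ (n + 1) f x) (w y : E) (i : Fin (n + 1)) :
    iteratedFDeriv ℝ (n + 1) f x (Function.update (fun _ => w) i y) =
      iteratedFDeriv ℝ (n + 1) f x (Function.update (fun _ => w) 0 y) := by
  induction n generalizing x with
  | zero => rw [Fin.fin_one_eq_zero i]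
  | succ n ih =>
    refine Fin.cases rfl (fun j => ?_) i
    have hf2 : ContDiffAt ℝ (n + 2) f x := by
      refine hf.of_le (le_of_eq ?_)
      push_cast
      rw [add_assoc, one_add_one_eq_two]
    rw [iteratedFDeriv_update_zero_eq_update_one hf2]
    have hd : DifferentiableAt ℝ (iteratedFDeriv ℝ (n + 1) f) x :=
      hf.differentiableAt_iteratedFDeriv (by exact_mod_cast Nat.lt_succ_self (n + 1))
    have htail : ∀ j : Fin (n + 1),
        Fin.tail (Function.update (fun _ : Fin (n + 2) => w) j.succ y) =
          Function.update (fun _ => w) j y := by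
      intro j
      rw [Fin.tail_update_succ]
      rfl
    have h1 : (1 : Fin (n + 2)) = (0 : Fin (n + 1)).succ := rfl
    -- The induction hypothesis is needed at all points near `x`, because it is going to be
    -- differentiated; smoothness of finite order is an open condition.
    have hev : ∀ᶠ x' in nhds x, ContDiffAt ℝ (n + 1) f x' :=
      (hf.of_le (by exact_mod_cast Nat.le_succ (n + 1))).eventually (by
        exact_mod_cast (ENat.natCast_ne_top (n + 1)))
    rw [hd.iteratedFDeriv_succ_apply_left', h1, hd.iteratedFDeriv_succ_apply_left', htail, htail,
      Function.update_of_ne (Fin.succ_ne_zero _).symm,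
      Function.update_of_ne (Fin.succ_ne_zero _).symm]
    congr 1
    refine Filter.EventuallyEq.fderiv_eq ?_
    filter_upwards [hev] with x' hx'
    exact ih hx' j

/-- The derivative of a diagonal value of an iterated derivative as a homogeneous polynomial. -/
theorem hasFDerivAt_iteratedFDeriv_diag {n : ℕ} {f : E → F} {x : E}
    (hf : ContDiffAt ℝ (n + 1) f x) (z : E) :
    HasFDerivAt (fun z => iteratedFDeriv ℝ (n + 1) f x (fun _ => z - x))
      ((n + 1 : ℝ) • iteratedFDeriv ℝ n (fderiv ℝ f) x (fun _ => z - x)) z := by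
  have h1 := (iteratedFDeriv ℝ (n + 1) f x).hasFDerivAt (x := fun _ => z - x)
  have h2 : HasFDerivAt (fun z : E => fun _ : Fin (n + 1) => z - x)
      (ContinuousLinearMap.pi fun _ => ContinuousLinearMap.id ℝ E) z :=
    hasFDerivAt_pi.2 fun _ => (hasFDerivAt_id z).sub_const x
  refine (h1.comp z h2).congr_fderiv ?_
  ext y
  -- By symmetry the exceptional entry may be moved to the last slot, which is the argument of
  -- `fderiv ℝ f`; hence the `n + 1` partial derivatives coincide.
  have h3 : ∀ i : Fin (n + 1),
      iteratedFDeriv ℝ (n + 1) f x (Function.update (fun _ => z - x) i y) =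
        iteratedFDeriv ℝ n (fderiv ℝ f) x (fun _ => z - x) y := by
    intro i
    rw [iteratedFDeriv_update_eq_update_zero hf,
      ← iteratedFDeriv_update_eq_update_zero hf _ _ (Fin.last n), iteratedFDeriv_succ_apply_right,
      Fin.init_update_last, Function.update_self]
    rfl
  simp only [ContinuousLinearMap.comp_apply, ContinuousMultilinearMap.linearDeriv_apply,
    ContinuousLinearMap.pi_apply, ContinuousLinearMap.id_apply, h3, Finset.sum_const,
    Finset.card_univ, Fintype.card_fin, smul_apply]
  rw [← Nat.cast_smul_eq_nsmul ℝ]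
  push_cast
  rfl

end Taylor

/-! ### A potential for the regularized model. -/

section RegularizedTaylor

variable {E : Type*} [NormedAddCommGroup E] [InnerProductSpace ℝ E]

/-- The regularized Taylor polynomial of `h`, whose gradient is the regularized model of `∇ h`. -/
noncomputable def regularizedTaylor (p : ℕ) (h : E → ℝ) (M : ℝ) (zbar z : E) : ℝ :=
  ∑ k ∈ Finset.range (p + 1), (k ! : ℝ)⁻¹ * iteratedFDeriv ℝ k h zbar (fun _ => z - zbar) +
    M / (p ! : ℝ) / (p + 1) * ‖z - zbar‖ ^ (p + 1)

theorem hasFDerivAt_norm_sub_pow_succ (n : ℕ) (x z : E) :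
    HasFDerivAt (fun z : E => ‖z - x‖ ^ (n + 2))
      (((n + 2 : ℝ) * ‖z - x‖ ^ n) • innerSL ℝ (z - x)) z := by
  have h1 := (hasFDerivAt_norm_rpow (z - x) (p := (n + 2 : ℝ)) (by
    have : (0 : ℝ) ≤ n := n.cast_nonneg
    linarith)).comp z ((hasFDerivAt_id z).sub_const x)
  have h2 : (fun z : E => ‖z - x‖ ^ (n + 2)) =
      (fun x : E => ‖x‖ ^ (n + 2 : ℝ)) ∘ fun z => id z - x := by
    funext y
    simp only [Function.comp_apply, id]
    rw [← Real.rpow_natCast]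
    push_cast
    rfl
  rw [h2]
  refine h1.congr_fderiv ?_
  rw [add_sub_cancel_right, Real.rpow_natCast]
  rfl

/-- Coercivity: outside the unit ball around `zbar` every Taylor term is at most a constant times
the `p`-th power of the distance, one order below the regularizer. -/
theorem le_regularizedTaylor (p : ℕ) (h : E → ℝ) (M : ℝ) (zbar : E) :
    ∃ C : ℝ, 0 ≤ C ∧ ∀ z, 1 ≤ ‖z - zbar‖ →
      M / (p ! : ℝ) / (p + 1) * ‖z - zbar‖ ^ (p + 1) - C * ‖z - zbar‖ ^ p ≤
        regularizedTaylor p h M zbar z := by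
  refine ⟨∑ k ∈ Finset.range (p + 1), (k ! : ℝ)⁻¹ * ‖iteratedFDeriv ℝ k h zbar‖,
    Finset.sum_nonneg fun k _ => by positivity, fun z hz => ?_⟩
  have h1 : ∀ k ∈ Finset.range (p + 1),
      -((k ! : ℝ)⁻¹ * ‖iteratedFDeriv ℝ k h zbar‖ * ‖z - zbar‖ ^ p) ≤
        (k ! : ℝ)⁻¹ * iteratedFDeriv ℝ k h zbar (fun _ => z - zbar) := by
    intro k hk
    have hk' : k ≤ p := Nat.lt_succ_iff.1 (Finset.mem_range.1 hk)
    have h2 := (iteratedFDeriv ℝ k h zbar).le_opNorm (fun _ => z - zbar)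
    rw [Finset.prod_const, Finset.card_univ, Fintype.card_fin] at h2
    have h3 : ‖z - zbar‖ ^ k ≤ ‖z - zbar‖ ^ p := pow_le_pow_right₀ hz hk'
    have h4 := (abs_le.1 (h2.trans (mul_le_mul_of_nonneg_left h3 (norm_nonneg _)))).1
    have h5 : (0 : ℝ) ≤ (k ! : ℝ)⁻¹ := by positivity
    have h6 := mul_le_mul_of_nonneg_left h4 h5
    linarith
  have h2 := Finset.sum_le_sum h1
  rw [Finset.sum_neg_distrib, ← Finset.sum_mul] at h2
  unfold regularizedTaylor
  linarith

/-- A point at which `f` is minimal over a convex set satisfies the variational inequality. -/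
theorem IsMinOn.fderiv_nonneg_of_convex {Z : Set E} (hZ : Convex ℝ Z) {f : E → ℝ}
    {f' : E →L[ℝ] ℝ} {x y : E} (hmin : IsMinOn f Z x) (hf : HasFDerivAt f f' x) (hx : x ∈ Z)
    (hy : y ∈ Z) : 0 ≤ f' (y - x) :=
  IsLocalMinOn.hasFDerivWithinAt_nonneg hmin.localize hf.hasFDerivWithinAt
    (sub_mem_posTangentConeAt_of_segment_subset (hZ.segment_subset hx hy))

end RegularizedTaylor

/-! ### Existence and accuracy of the tensor step. -/

section TensorStep

variable {E : Type*} [NormedAddCommGroup E] [InnerProductSpace ℝ E] [CompleteSpace E]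

theorem inner_gradient_eq_fderiv (h : E → ℝ) (x y : E) : ⟪∇ h x, y⟫ = fderiv ℝ h x y := by
  rw [gradient, InnerProductSpace.toDual_symm_apply]

/-- The Fréchet–Riesz isometry from the dual of a real Hilbert space. -/
noncomputable def rieszIsometry (E : Type*) [NormedAddCommGroup E] [InnerProductSpace ℝ E]
    [CompleteSpace E] : (E →L[ℝ] ℝ) ≃ₗᵢ[ℝ] E where
  toFun := (InnerProductSpace.toDual ℝ E).symm
  invFun := InnerProductSpace.toDual ℝ E
  map_add' := map_add _
  map_smul' c f := by simp
  left_inv := (InnerProductSpace.toDual ℝ E).apply_symm_apply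
  right_inv := (InnerProductSpace.toDual ℝ E).symm_apply_apply
  norm_map' := (InnerProductSpace.toDual ℝ E).symm.norm_map

theorem iteratedFDeriv_gradient_apply (h : E → ℝ) (k : ℕ) (x : E) (m : Fin k → E) :
    iteratedFDeriv ℝ k (∇ h) x m = rieszIsometry E (iteratedFDeriv ℝ k (fderiv ℝ h) x m) :=
  congrArg (fun T => T m) (ContinuousLinearEquiv.iteratedFDeriv_comp_left
    (rieszIsometry E).toContinuousLinearEquiv (f := fderiv ℝ h) (x := x) (i := k))

theorem inner_iteratedFDeriv_gradient (h : E → ℝ) (k : ℕ) (x y : E) (m : Fin k → E) :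
    ⟪iteratedFDeriv ℝ k (∇ h) x m, y⟫ = iteratedFDeriv ℝ k (fderiv ℝ h) x m y := by
  rw [iteratedFDeriv_gradient_apply]
  exact InnerProductSpace.toDual_symm_apply

theorem ContDiffAt.gradient {h : E → ℝ} {x : E} {n : ℕ} (hh : ContDiffAt ℝ (n + 1) h x) :
    ContDiffAt ℝ n (∇ h) x :=
  (rieszIsometry E).toContinuousLinearEquiv.contDiff.contDiffAt.comp x hh.fderiv_right_succ

/-- Currying and the Riesz map are isometries, so the Lipschitz bound on the `p`-th derivative of
`h` passes to the derivative of order `p - 1` of the gradient. -/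
theorem norm_iteratedFDeriv_gradient_sub_le (h : E → ℝ) (n : ℕ) (x x' : E) (m : Fin n → E) :
    ‖iteratedFDeriv ℝ n (∇ h) x m - iteratedFDeriv ℝ n (∇ h) x' m‖ ≤
      ‖iteratedFDeriv ℝ (n + 1) h x - iteratedFDeriv ℝ (n + 1) h x'‖ * ∏ i, ‖m i‖ := by
  have h1 : ‖iteratedFDeriv ℝ (n + 1) h x - iteratedFDeriv ℝ (n + 1) h x'‖ =
      ‖iteratedFDeriv ℝ n (fderiv ℝ h) x - iteratedFDeriv ℝ n (fderiv ℝ h) x'‖ := by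
    rw [iteratedFDeriv_succ_eq_comp_right, iteratedFDeriv_succ_eq_comp_right,
      Function.comp_apply, Function.comp_apply]
    exact (congrArg norm (LinearIsometryEquiv.map_sub _ _ _).symm).trans
      (LinearIsometryEquiv.norm_map _ _)
  rw [h1, iteratedFDeriv_gradient_apply, iteratedFDeriv_gradient_apply, ← map_sub,
    LinearIsometryEquiv.norm_map, ← sub_apply]
  exact ContinuousMultilinearMap.le_opNorm _ _

/-- The error of the Taylor expansion of the gradient. -/
theorem norm_gradient_sub_taylorField_le {p : ℕ} (hp : 1 ≤ p) {L : ℝ} {Z : Set E} {h : E → ℝ}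
    (hZ : Convex ℝ Z) (hL : LipschitzDerivOn p L Z h) {zbar z : E} (hzbar : zbar ∈ Z)
    (hz : z ∈ Z) :
    ‖∇ h z - taylorField p (∇ h) zbar z‖ ≤ L / (p ! : ℝ) * ‖z - zbar‖ ^ p := by
  obtain ⟨n, rfl⟩ : ∃ n, p = n + 1 := ⟨p - 1, by omega⟩
  set w := z - zbar with hw
  have hmem : ∀ s ∈ Set.Icc (0 : ℝ) 1, zbar + s • w ∈ Z := fun s hs =>
    hZ.add_smul_sub_mem hzbar hz hs
  have key := norm_sub_taylor_le_of_norm_sub_le (K := L * ‖w‖ ^ (n + 1)) n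
    (fun i s => iteratedFDeriv ℝ i (∇ h) (zbar + s • w) (fun _ => w)) ?_ ?_ 1 (by simp)
  · simp only [one_smul, iteratedFDeriv_zero_apply, one_pow, mul_one, zero_smul, add_zero] at key
    have hzw : zbar + w = z := by simp [hw]
    rw [hzw] at key
    refine key.trans (le_of_eq ?_)
    ring
  · intro i hi s hs
    refine hasDerivAt_iteratedFDeriv_add_smul ?_
    have h1 := hL.1 _ (hmem s hs)
    have h2 : ContDiffAt ℝ n (∇ h) (zbar + s • w) := ContDiffAt.gradient (by exact_mod_cast h1)
    exact h2.of_le (by exact_mod_cast hi)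
  · intro s hs
    refine (norm_iteratedFDeriv_gradient_sub_le h n _ _ _).trans ?_
    have h1 := hL.2 _ (hmem s hs) _ (hmem 0 (by simp))
    have h2 : ‖zbar + s • w - (zbar + (0 : ℝ) • w)‖ = s * ‖w‖ := by
      rw [zero_smul, add_zero, add_sub_cancel_left, norm_smul, Real.norm_of_nonneg hs.1]
    rw [h2] at h1
    rw [Finset.prod_const, Finset.card_univ, Fintype.card_fin]
    calc _ ≤ L * (s * ‖w‖) * ‖w‖ ^ n := by gcongr
      _ = _ := by ring

/-- The model is a gradient field, so its variational inequality is the first-order condition of a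
minimization over `Z`. -/
theorem hasFDerivAt_regularizedTaylor {p : ℕ} (hp : 1 ≤ p) {h : E → ℝ} {zbar : E}
    (hh : ContDiffAt ℝ p h zbar) (M : ℝ) (z : E) :
    HasFDerivAt (regularizedTaylor p h M zbar)
      (innerSL ℝ (regularizedModel p (∇ h) M zbar z)) z := by
  obtain ⟨n, rfl⟩ : ∃ n, p = n + 1 := ⟨p - 1, by omega⟩
  have h1 : HasFDerivAt (fun z => ∑ k ∈ Finset.range (n + 1 + 1),
      (k ! : ℝ)⁻¹ * iteratedFDeriv ℝ k h zbar (fun _ => z - zbar))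
      (∑ k ∈ Finset.range (n + 1),
        (k ! : ℝ)⁻¹ • iteratedFDeriv ℝ k (fderiv ℝ h) zbar (fun _ => z - zbar)) z := by
    simp only [Finset.sum_range_succ' _ (n + 1)]
    simp only [iteratedFDeriv_zero_apply]
    refine HasFDerivAt.add_const _ ?_
    refine HasFDerivAt.fun_sum fun k hk => ?_
    have hk' : k + 1 ≤ n + 1 := Finset.mem_range.1 hk
    have h2 := (hasFDerivAt_iteratedFDeriv_diag (n := k)
      (hh.of_le (by exact_mod_cast hk')) z).const_mul ((((k + 1)! : ℕ) : ℝ)⁻¹)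
    refine h2.congr_fderiv ?_
    rw [smul_smul]
    congr 1
    have h3 : ((k ! : ℕ) : ℝ) ≠ 0 := by positivity
    rw [Nat.factorial_succ]
    push_cast
    field_simp
  refine (h1.add ((hasFDerivAt_norm_sub_pow_succ n zbar z).const_mul
    (M / ((n + 1)! : ℝ) / ((n + 1 : ℕ) + 1)))).congr_fderiv ?_
  ext y
  simp only [regularizedModel, taylorField, innerSL_apply_apply, inner_add_left, sum_inner,
    real_inner_smul_left, inner_iteratedFDeriv_gradient, add_apply,
    smul_apply, sum_apply, smul_eq_mul, Nat.add_sub_cancel]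
  congr 1
  push_cast
  field_simp
  ring

/-- A coercive continuous potential attains its minimum on a closed subset of a proper space. No
monotonicity of the model is needed. -/
theorem exists_isTensorStep [ProperSpace E] {p : ℕ} (hp : 1 ≤ p) {Z : Set E} (hZc : IsClosed Z)
    (hZ : Convex ℝ Z) {h : E → ℝ} {M : ℝ} (hM : 0 < M) {zbar : E} (hzbar : zbar ∈ Z)
    (hh : ContDiffAt ℝ p h zbar) : ∃ z, IsTensorStep p (∇ h) M Z zbar z := by
  have hderiv := hasFDerivAt_regularizedTaylor hp hh M
  have hcont : Continuous (regularizedTaylor p h M zbar) :=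
    continuous_iff_continuousAt.2 fun z => (hderiv z).continuousAt
  obtain ⟨C, hC, hbound⟩ := le_regularizedTaylor p h M zbar
  set m := M / (p ! : ℝ) / (p + 1) with hm
  have hm0 : 0 < m := by positivity
  have htend : Filter.Tendsto (fun z : E => ‖z - zbar‖) (Filter.cocompact E) Filter.atTop :=
    tendsto_norm_cocompact_atTop.comp (Homeomorph.subRight zbar).isClosedEmbedding.tendsto_cocompact
  have hev : ∀ᶠ z in Filter.cocompact E,
      regularizedTaylor p h M zbar zbar ≤ regularizedTaylor p h M zbar z := by
    filter_upwards [htend.eventually_ge_atTop 1,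
      htend.eventually_ge_atTop ((C + |regularizedTaylor p h M zbar zbar|) / m)] with z h1 h2
    refine le_trans ?_ (hbound z h1)
    rw [div_le_iff₀ hm0] at h2
    have h3 : 1 ≤ ‖z - zbar‖ ^ p := one_le_pow₀ h1
    have h4 := abs_nonneg (regularizedTaylor p h M zbar zbar)
    calc regularizedTaylor p h M zbar zbar ≤ |regularizedTaylor p h M zbar zbar| := le_abs_self _
      _ ≤ ‖z - zbar‖ ^ p * |regularizedTaylor p h M zbar zbar| := le_mul_of_one_le_left h4 h3
      _ ≤ ‖z - zbar‖ ^ p * (‖z - zbar‖ * m - C) := by gcongr; linarith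
      _ = _ := by ring
  obtain ⟨z, hz, hmin⟩ := hcont.continuousOn.exists_isMinOn' hZc hzbar
    (hev.filter_mono inf_le_left)
  exact ⟨z, hz, fun z' hz' => hmin.fderiv_nonneg_of_convex hZ (hderiv z) hz hz'⟩

/-- The sum of the gradient and the normal vector returned by a tensor step is close to a negative
multiple of the displacement. -/
theorem IsTensorProx.norm_add_smul_le {p : ℕ} (hp : 1 ≤ p) {L : ℝ} {Z : Set E} {h : E → ℝ}
    (hZ : Convex ℝ Z) (hL : LipschitzDerivOn p L Z h) {zbar zt u : E} (hzbar : zbar ∈ Z)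
    (hprox : IsTensorProx p (2 * L) Z h zbar zt u) :
    ‖∇ h zt + u + (2 * (L * ‖zt - zbar‖ ^ (p - 1) / (p ! : ℝ))) • (zt - zbar)‖ ≤
      L * ‖zt - zbar‖ ^ (p - 1) / (p ! : ℝ) * ‖zt - zbar‖ := by
  obtain ⟨⟨hzt, -⟩, rfl⟩ := hprox
  have h1 := norm_gradient_sub_taylorField_le hp hZ hL hzbar hzt
  have h2 : ∇ h zt + -regularizedModel p (∇ h) (2 * L) zbar zt +
      (2 * (L * ‖zt - zbar‖ ^ (p - 1) / (p ! : ℝ))) • (zt - zbar) =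
        ∇ h zt - taylorField p (∇ h) zbar zt := by
    have h3 : 2 * (L * ‖zt - zbar‖ ^ (p - 1) / (p ! : ℝ)) =
        2 * L / (p ! : ℝ) * ‖zt - zbar‖ ^ (p - 1) := by ring
    rw [regularizedModel, h3]
    abel
  rw [h2]
  refine h1.trans (le_of_eq ?_)
  obtain ⟨n, rfl⟩ : ∃ n, p = n + 1 := ⟨p - 1, by omega⟩
  rw [Nat.add_sub_cancel]
  ring

end TensorStep

/-! ### Growth of the weights under halving and doubling of the guess. -/

section Growth

/-- As `Y ^ b = (√Y) ^ (2b)` with `2b ≤ 1`, Bernoulli's inequality bounds the increment below by `2b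
* Y' ^ b` times the relative growth of the square root. The latter is at least `1 / (2 √(lam Y'))`,
and `hlow` gives `√(lam Y') ≤ √8 * Y' ^ b ≤ 3 * Y' ^ b`. -/
theorem rpow_sub_rpow_ge_of_sqrt_add_le {b lam Y Y' : ℝ} (hb : 0 < b) (hb2 : b ≤ 1 / 2)
    (hlam : 0 < lam) (hY : 0 < Y) (hYY' : Y ≤ Y')
    (hsqrt : √Y + 1 / (2 * √lam) ≤ √Y') (hlow : lam * Y' ^ (1 - 2 * b) ≤ 8) :
    b / 3 ≤ Y' ^ b - Y ^ b := by
  have hY' : 0 < Y' := hY.trans_le hYY'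
  set y := √Y with hy
  set y' := √Y' with hy'
  have hy0 : 0 < y := Real.sqrt_pos.2 hY
  have hy'0 : 0 < y' := Real.sqrt_pos.2 hY'
  have hl0 : 0 < √lam := Real.sqrt_pos.2 hlam
  have hYb : Y ^ b = y ^ (2 * b) := by
    rw [hy, Real.sqrt_eq_rpow, ← Real.rpow_mul hY.le]
    congr 1
    ring
  have hY'b : Y' ^ b = y' ^ (2 * b) := by
    rw [hy', Real.sqrt_eq_rpow, ← Real.rpow_mul hY'.le]
    congr 1
    ring
  have hbern : (y / y') ^ (2 * b) ≤ 1 + 2 * b * (y / y' - 1) := by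
    have h1 : 0 < y / y' := by positivity
    have := rpow_one_add_le_one_add_mul_self (s := y / y' - 1) (by linarith) (p := 2 * b)
      (by linarith) (by linarith)
    simpa using this
  have hY'pos : 0 < Y' ^ b := Real.rpow_pos_of_pos hY' b
  have hdiff : Y' ^ b * (2 * b * (1 - y / y')) ≤ Y' ^ b - Y ^ b := by
    have h1 : Y ^ b = Y' ^ b * (y / y') ^ (2 * b) := by
      rw [Real.div_rpow hy0.le hy'0.le, hYb, hY'b]
      have : y' ^ (2 * b) ≠ 0 := (Real.rpow_pos_of_pos hy'0 _).ne'
      field_simp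
    rw [h1]
    have := mul_le_mul_of_nonneg_left hbern hY'pos.le
    linarith
  refine le_trans ?_ hdiff
  have h1 : 1 / (2 * √lam * y') ≤ 1 - y / y' := by
    have h2 : 1 - y / y' = (y' - y) / y' := by field_simp
    rw [h2, ← div_div]
    gcongr
    linarith
  have h3 : √lam * y' ≤ 3 * Y' ^ b := by
    have h4 : (√lam * y') ^ 2 ≤ (3 * Y' ^ b) ^ 2 := by
      rw [mul_pow, hy', Real.sq_sqrt hlam.le, Real.sq_sqrt hY'.le]
      have h5 : Y' = Y' ^ (1 - 2 * b) * (Y' ^ b) ^ 2 := by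
        rw [← Real.rpow_natCast, ← Real.rpow_mul hY'.le, ← Real.rpow_add hY']
        norm_num
        rw [show 1 - 2 * b + b * 2 = 1 by ring, Real.rpow_one]
      have h6 : 0 ≤ (Y' ^ b) ^ 2 := by positivity
      calc lam * Y' = lam * Y' ^ (1 - 2 * b) * (Y' ^ b) ^ 2 := by
            conv_lhs => rw [h5]
            ring
        _ ≤ 8 * (Y' ^ b) ^ 2 := by gcongr
        _ ≤ _ := by nlinarith
    exact (sq_le_sq₀ (by positivity) (by positivity)).1 h4
  calc b / 3 = Y' ^ b * (2 * b * (1 / (2 * (3 * Y' ^ b)))) := by field_simp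
    _ ≤ Y' ^ b * (2 * b * (1 / (2 * (√lam * y')))) := by gcongr
    _ = Y' ^ b * (2 * b * (1 / (2 * √lam * y'))) := by ring_nf
    _ ≤ _ := by gcongr

/-- The value of `b` is the one with `(p - 1) * (3b / 2) = 1 - 2b`. A step `ρ` shorter than `Y ^
(-3b/2)` would force `lam * Y ^ (1 - 2b) ≤ 1`; with `ρ` at least that long, the powers of `Y`
combine to `Y ^ (1 - 2b)` again. -/
theorem two_le_rpow_mul_of_le_pow {p : ℕ} (hp : 1 ≤ p) {b lam Y ρ : ℝ}
    (hb : b = 2 / (3 * p + 1)) (hY : 0 < Y) (hρ : 0 ≤ ρ)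
    (hlamρ : lam ≤ ρ ^ (p - 1)) (hhigh : 2 ≤ lam * Y ^ (1 - 2 * b)) :
    2 ≤ Y ^ b * (Y * lam * ρ ^ 2) := by
  have he : (1 - 2 * b) = (3 * b / 2) * (p - 1 : ℕ) := by
    rw [hb, Nat.cast_sub hp]
    field_simp
    push_cast
    ring
  have hYe : 0 < Y ^ (1 - 2 * b) := Real.rpow_pos_of_pos hY _
  have hρlow : Y ^ (-(3 * b / 2)) ≤ ρ := by
    by_contra hcon
    push Not at hcon
    have h1 : ρ ^ (p - 1) ≤ (Y ^ (-(3 * b / 2))) ^ (p - 1) := pow_le_pow_left₀ hρ hcon.le _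
    rw [← Real.rpow_natCast (Y ^ _), ← Real.rpow_mul hY.le, neg_mul, ← he] at h1
    have h2 : lam * Y ^ (1 - 2 * b) ≤ Y ^ (-(1 - 2 * b)) * Y ^ (1 - 2 * b) := by
      gcongr
      exact hlamρ.trans h1
    rw [← Real.rpow_add hY, neg_add_cancel, Real.rpow_zero] at h2
    linarith
  have h3 : (Y ^ (-(3 * b / 2))) ^ 2 ≤ ρ ^ 2 :=
    pow_le_pow_left₀ (Real.rpow_pos_of_pos hY _).le hρlow 2
  have h4 : Y ^ b * Y * (Y ^ (-(3 * b / 2))) ^ 2 = Y ^ (1 - 2 * b) := by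
    rw [← Real.rpow_natCast (Y ^ (-(3 * b / 2))), ← Real.rpow_mul hY.le]
    nth_rewrite 2 [← Real.rpow_one Y]
    rw [← Real.rpow_add hY, ← Real.rpow_add hY]
    congr 1
    push_cast
    ring
  have hlam : 0 ≤ lam := by
    by_contra hcon
    push Not at hcon
    nlinarith
  calc (2 : ℝ) ≤ lam * Y ^ (1 - 2 * b) := hhigh
    _ = Y ^ b * Y * lam * (Y ^ (-(3 * b / 2))) ^ 2 := by rw [← h4]; ring
    _ ≤ Y ^ b * Y * lam * ρ ^ 2 := by gcongr
    _ = _ := by ring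

theorem logb_two_mul_rpow {e lam Y : ℝ} (hlam : 0 < lam) (hY : 0 < Y) :
    Real.logb 2 (lam * Y ^ e) = Real.logb 2 lam + e * Real.logb 2 Y := by
  rw [Real.logb_mul hlam.ne' (Real.rpow_pos_of_pos hY _).ne', Real.logb_rpow_eq_mul_logb_of_pos hY]

/-- One iteration decreases the distance of the logarithm of the guess from its balanced value,
unless the iteration is paid for by growth or by a loss of energy. -/
theorem abs_logb_balance_step {p : ℕ} (hp : 1 ≤ p) {b lam lam' Y Y' W δ : ℝ}
    (hb : b = 2 / (3 * p + 1)) (hlam : 0 < lam) (hY : 0 < Y) (hYY' : Y ≤ Y') (hYW : Y ≤ W)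
    (hδ : 0 ≤ δ)
    (hstep : (lam' = lam / 2 ∧ √Y + 1 / (2 * √lam) ≤ √Y') ∨
      (lam' = 2 * lam ∧ ∃ ρ : ℝ, 0 ≤ ρ ∧ lam ≤ ρ ^ (p - 1) ∧ Y * lam * ρ ^ 2 ≤ δ)) :
    |Real.logb 2 lam' + (1 - 2 * b) * Real.logb 2 Y' - 2| + 1 ≤
      |Real.logb 2 lam + (1 - 2 * b) * Real.logb 2 Y - 2| + 6 / b * (Y' ^ b - Y ^ b) +
        (1 - 2 * b) * (Real.logb 2 Y' - Real.logb 2 Y) + W ^ b * δ := by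
  have hp' : (1 : ℝ) ≤ p := by exact_mod_cast hp
  have hb0 : 0 < b := by rw [hb]; positivity
  have hb2 : b ≤ 1 / 2 := by
    rw [hb, div_le_div_iff₀ (by positivity) (by norm_num)]
    linarith
  have hY' : 0 < Y' := hY.trans_le hYY'
  have hW : 0 < W := hY.trans_le hYW
  have hWδ : 0 ≤ W ^ b * δ := mul_nonneg (Real.rpow_pos_of_pos hW _).le hδ
  have hgain : 0 ≤ 6 / b * (Y' ^ b - Y ^ b) :=
    mul_nonneg (by positivity) (sub_nonneg.2 (Real.rpow_le_rpow hY.le hYY' hb0.le))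
  have hlog : Real.logb 2 Y ≤ Real.logb 2 Y' := Real.logb_le_logb_of_le (by norm_num) hY hYY'
  have hinc : 0 ≤ (1 - 2 * b) * (Real.logb 2 Y' - Real.logb 2 Y) :=
    mul_nonneg (by linarith) (sub_nonneg.2 hlog)
  have hpow : ∀ (q : ℝ), 0 < q → ∀ k : ℝ, Real.logb 2 q ≤ k → q ≤ 2 ^ k := fun q hq k h =>
    (Real.logb_le_iff_le_rpow (by norm_num) hq).1 h
  set D := Real.logb 2 lam + (1 - 2 * b) * Real.logb 2 Y - 2 with hD
  set I := (1 - 2 * b) * (Real.logb 2 Y' - Real.logb 2 Y) with hI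
  rcases hstep with ⟨rfl, hsqrt⟩ | ⟨rfl, ρ, hρ, hlamρ, hloss⟩
  · have h1 : Real.logb 2 (lam / 2) = Real.logb 2 lam - 1 := by
      rw [Real.logb_div hlam.ne' (by norm_num), Real.logb_self_eq_one (by norm_num)]
    have h2 : Real.logb 2 (lam / 2) + (1 - 2 * b) * Real.logb 2 Y' - 2 = D + I - 1 := by
      rw [h1, hD, hI]
      ring
    rw [h2]
    by_cases hcase : D + I ≤ 1
    · have h3 : lam * Y' ^ (1 - 2 * b) ≤ 8 := by
        have h4 := hpow _ (mul_pos hlam (Real.rpow_pos_of_pos hY' (1 - 2 * b))) 3 (by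
          rw [logb_two_mul_rpow hlam hY']
          rw [hD, hI] at hcase
          linarith)
        norm_num at h4
        exact h4
      have h4 := rpow_sub_rpow_ge_of_sqrt_add_le hb0 hb2 hlam hY hYY' hsqrt h3
      have h5 : 2 ≤ 6 / b * (Y' ^ b - Y ^ b) := by
        calc (2 : ℝ) = 6 / b * (b / 3) := by field_simp; norm_num
          _ ≤ _ := by gcongr
      have h6 : |D + I - 1| ≤ |D| + I + 1 := by
        have := le_abs_self D
        have := neg_abs_le D
        rw [abs_le]
        constructor <;> linarith
      linarith
    · push Not at hcase
      rw [abs_of_pos (by linarith)]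
      have := le_abs_self D
      linarith
  · have h1 : Real.logb 2 (2 * lam) = Real.logb 2 lam + 1 := by
      rw [Real.logb_mul (by norm_num) hlam.ne', Real.logb_self_eq_one (by norm_num)]
      ring
    have h2 : Real.logb 2 (2 * lam) + (1 - 2 * b) * Real.logb 2 Y' - 2 = D + I + 1 := by
      rw [h1, hD, hI]
      ring
    rw [h2]
    -- This condition means `lam * Y ^ (1 - 2b) ≥ 2`, and then the energy loss pays `2`. Otherwise
    -- the doubling moves towards balance.
    by_cases hcase : -1 ≤ D
    · have h3 : 2 ≤ lam * Y ^ (1 - 2 * b) := by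
        have h4 : (1 : ℝ) ≤ Real.logb 2 (lam * Y ^ (1 - 2 * b)) := by
          rw [logb_two_mul_rpow hlam hY]
          rw [hD] at hcase
          linarith
        have h5 := (Real.le_logb_iff_rpow_le (by norm_num)
          (mul_pos hlam (Real.rpow_pos_of_pos hY (1 - 2 * b)))).1 h4
        rwa [Real.rpow_one] at h5
      have h4 := two_le_rpow_mul_of_le_pow hp hb hY hρ hlamρ h3
      have h5 : 2 ≤ W ^ b * δ := by
        refine h4.trans ?_
        have h6 : Y ^ b ≤ W ^ b := Real.rpow_le_rpow hY.le hYW hb0.le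
        have h7 : 0 ≤ Y ^ b := (Real.rpow_pos_of_pos hY _).le
        gcongr
      have h6 : |D + I + 1| ≤ |D| + I + 1 := by
        have := le_abs_self D
        have := neg_abs_le D
        rw [abs_le]
        constructor <;> linarith
      linarith
    · push Not at hcase
      have h3 : |D + I + 1| ≤ -D + I - 1 := by
        rw [abs_le]
        constructor <;> linarith
      have := neg_abs_le D
      linarith

/-- Growth of the weights of accelerated iterations with guesses that are halved or doubled. -/
theorem succ_le_mul_rpow_of_halving_doubling {p : ℕ} (hp : 1 ≤ p) {b : ℝ}
    (hb : b = 2 / (3 * p + 1)) {n : ℕ} {Y lam en : ℕ → ℝ} (hY0 : 1 ≤ Y 0) (hlam0 : 0 < lam 0)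
    (hprod : Y 0 * lam 0 = 1 / 2) (hmono : ∀ t < n, Y t ≤ Y (t + 1)) (hen0 : en 0 ≤ 1)
    (hen : 0 ≤ en n) (hanti : ∀ t < n, en (t + 1) ≤ en t)
    (hstep : ∀ t < n, (lam (t + 1) = lam t / 2 ∧ √(Y t) + 1 / (2 * √(lam t)) ≤ √(Y (t + 1))) ∨
      (lam (t + 1) = 2 * lam t ∧ ∃ ρ : ℝ, 0 ≤ ρ ∧ lam t ≤ ρ ^ (p - 1) ∧
        Y t * lam t * ρ ^ 2 ≤ en t - en (t + 1))) :
    (n + 1 : ℝ) ≤ (5 + 8 / b) * Y n ^ b := by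
  have hp' : (1 : ℝ) ≤ p := by exact_mod_cast hp
  have hb0 : 0 < b := by rw [hb]; positivity
  have hb2 : b ≤ 1 / 2 := by
    rw [hb, div_le_div_iff₀ (by positivity) (by norm_num)]
    linarith
  have hY : ∀ t ≤ n, 1 ≤ Y t := by
    intro t ht
    induction t with
    | zero => exact hY0
    | succ t ih => exact (ih (by omega)).trans (hmono t (by omega))
  have hlam : ∀ t ≤ n, 0 < lam t := by
    intro t ht
    induction t with
    | zero => exact hlam0
    | succ t ih =>
      have := ih (by omega)
      rcases hstep t (by omega) with ⟨h, -⟩ | ⟨h, -⟩ <;> rw [h] <;> positivity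
  have hYn : ∀ t ≤ n, Y t ≤ Y n := by
    intro t ht
    induction ht using Nat.decreasingInduction with
    | self => exact le_rfl
    | of_succ t ht ih => exact (hmono t ht).trans ih
  set D : ℕ → ℝ := fun t => Real.logb 2 (lam t) + (1 - 2 * b) * Real.logb 2 (Y t) - 2 with hD
  have key : ∀ t ≤ n, (t : ℝ) + |D t| ≤ |D 0| + 6 / b * (Y t ^ b - Y 0 ^ b) +
      (1 - 2 * b) * (Real.logb 2 (Y t) - Real.logb 2 (Y 0)) + Y n ^ b * (en 0 - en t) := by
    intro t ht
    induction t with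
    | zero => simp
    | succ t ih =>
      have h1 := ih (by omega)
      have h2 := abs_logb_balance_step hp hb (hlam t (by omega))
        (zero_lt_one.trans_le (hY t (by omega))) (hmono t (by omega)) (hYn t (by omega))
        (sub_nonneg.2 (hanti t (by omega))) (hstep t (by omega))
      have h3 : |D (t + 1)| + 1 ≤ |D t| + 6 / b * (Y (t + 1) ^ b - Y t ^ b) +
        (1 - 2 * b) * (Real.logb 2 (Y (t + 1)) - Real.logb 2 (Y t)) +
          Y n ^ b * (en t - en (t + 1)) := h2
      push_cast
      linarith
  have hn := key n le_rfl
  have hYn1 := hY n le_rfl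
  have hY00 : 0 < Y 0 := zero_lt_one.trans_le hY0
  have hl0 : 0 ≤ Real.logb 2 (Y 0) := Real.logb_nonneg (by norm_num) hY0
  have hD0 : |D 0| ≤ 3 + 2 * b * Real.logb 2 (Y 0) := by
    have h1 : Real.logb 2 (Y 0) + Real.logb 2 (lam 0) = -1 := by
      rw [← Real.logb_mul hY00.ne' hlam0.ne', hprod, one_div, Real.logb_inv,
        Real.logb_self_eq_one (by norm_num)]
    have h2 : D 0 = -(3 + 2 * b * Real.logb 2 (Y 0)) := by
      simp only [hD]
      linear_combination h1
    rw [h2, abs_neg, abs_of_nonneg]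
    positivity
  have hl0n : Real.logb 2 (Y 0) ≤ Real.logb 2 (Y n) :=
    Real.logb_le_logb_of_le (by norm_num) hY00 (hYn 0 (Nat.zero_le _))
  have hYb : 1 ≤ Y n ^ b := Real.one_le_rpow hYn1 hb0.le
  have hY0b : 0 ≤ Y 0 ^ b := (Real.rpow_pos_of_pos hY00 _).le
  have hlogn : Real.logb 2 (Y n) ≤ 2 / b * Y n ^ b := by
    have h1 : Real.log (Y n) ≤ Y n ^ b / b :=
      Real.log_le_rpow_div (zero_le_one.trans hYn1) hb0
    have h2 : (1 / 2 : ℝ) < Real.log 2 := by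
      have := Real.log_two_gt_d9
      linarith
    have h3 : 0 ≤ Real.log (Y n) := Real.log_nonneg hYn1
    rw [Real.logb, div_le_iff₀ (by linarith)]
    have h4 : 0 ≤ 2 / b * Y n ^ b := by positivity
    calc Real.log (Y n) ≤ Y n ^ b / b := h1
      _ = 2 / b * Y n ^ b * (1 / 2) := by ring
      _ ≤ _ := by gcongr
  -- The initial imbalance and the total drift of the balance point together cost at most one
  -- logarithm of the final weight.
  have h1 : 2 * b * Real.logb 2 (Y 0) + (1 - 2 * b) * (Real.logb 2 (Y n) - Real.logb 2 (Y 0)) ≤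
      Real.logb 2 (Y n) := by
    nlinarith [mul_nonneg hb0.le (sub_nonneg.2 hl0n)]
  have h2 : Y n ^ b * (en 0 - en n) ≤ Y n ^ b := mul_le_of_le_one_right (by linarith) (by linarith)
  have h3 : 0 ≤ 6 / b * Y 0 ^ b := by positivity
  have h4 := abs_nonneg (D n)
  have h5 : (5 + 8 / b) * Y n ^ b = 5 * Y n ^ b + 6 / b * Y n ^ b + 2 / b * Y n ^ b := by ring
  linarith

end Growth

/-! ### Decrease of the energy in one iteration. -/

section Energy

variable {E : Type*} [NormedAddCommGroup E] [InnerProductSpace ℝ E]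

theorem IsProj.inner_nonpos {Z : Set E} (hZ : Convex ℝ Z) {x w y : E} (hw : IsProj Z x w)
    (hy : y ∈ Z) : ⟪x - w, y - w⟫ ≤ 0 := by
  have : Nonempty Z := ⟨⟨w, hw.1⟩⟩
  refine (norm_eq_iInf_iff_real_inner_le_zero hZ hw.1).1 ?_ y hy
  refine le_antisymm (le_ciInf fun z => hw.2 z z.2) ?_
  exact ciInf_le (f := fun z : Z => ‖x - z‖) ⟨0, by rintro _ ⟨z, rfl⟩; positivity⟩ ⟨w, hw.1⟩

theorem IsProj.norm_sub_sq_le {Z : Set E} (hZ : Convex ℝ Z) {x w y : E} (hw : IsProj Z x w)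
    (hy : y ∈ Z) : ‖w - y‖ ^ 2 ≤ ‖x - y‖ ^ 2 := by
  have h1 := hw.inner_nonpos hZ hy
  have h2 : ‖x - y‖ ^ 2 = ‖x - w‖ ^ 2 - 2 * ⟪x - w, y - w⟫ + ‖y - w‖ ^ 2 := by
    rw [← norm_sub_sq_real, sub_sub_sub_cancel_right]
  rw [norm_sub_rev w y, h2]
  nlinarith [sq_nonneg ‖x - w‖]

theorem exists_isProj [CompleteSpace E] {Z : Set E} (hZc : IsClosed Z) (hZ : Convex ℝ Z)
    (hne : Z.Nonempty) (x : E) : ∃ w, IsProj Z x w := by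
  obtain ⟨w, hw, hmin⟩ := exists_norm_eq_iInf_of_complete_convex hne hZc.isComplete hZ x
  refine ⟨w, hw, fun y hy => ?_⟩
  rw [hmin]
  exact ciInf_le (f := fun z : Z => ‖x - z‖) ⟨0, by rintro _ ⟨z, rfl⟩; positivity⟩ ⟨y, hy⟩

/-- A vector within `κ ‖w‖` of `-2 κ w` is negatively correlated with `w`. -/
theorem inner_add_sq_le_of_norm_add_smul_le {g w : E} {κ gam lam : ℝ} (hκ : 0 ≤ κ)
    (hlam : 0 < lam) (hle : gam * κ ≤ lam) (h : ‖g + (2 * κ) • w‖ ≤ κ * ‖w‖) :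
    ⟪g, w⟫ + gam / (4 * lam) * ‖g‖ ^ 2 ≤ -(3 / 4 * κ * ‖w‖ ^ 2) := by
  have h1 : ‖g + (2 * κ) • w‖ ^ 2 ≤ (κ * ‖w‖) ^ 2 := pow_le_pow_left₀ (norm_nonneg _) h 2
  rw [norm_add_sq_real, real_inner_smul_right, norm_smul, Real.norm_of_nonneg (by positivity)] at h1
  rcases hκ.eq_or_lt with rfl | hκ
  · have h2 : g = 0 := by simpa using h
    simp [h2]
  · have h2 : gam / (4 * lam) * ‖g‖ ^ 2 ≤ 1 / (4 * κ) * ‖g‖ ^ 2 := by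
      gcongr ?_ * _
      rw [div_le_div_iff₀ (by positivity) (by positivity)]
      linarith
    have h3 : 1 / (4 * κ) * ‖g‖ ^ 2 ≤ 1 / (4 * κ) * (-(4 * κ * ⟪g, w⟫) - 3 * κ ^ 2 * ‖w‖ ^ 2) := by
      gcongr
      nlinarith
    have h4 : 1 / (4 * κ) * (-(4 * κ * ⟪g, w⟫) - 3 * κ ^ 2 * ‖w‖ ^ 2) =
        -⟪g, w⟫ - 3 / 4 * κ * ‖w‖ ^ 2 := by
      field_simp
    linarith

variable [CompleteSpace E]

theorem UniformlyConvex.add_inner_le {q : ℕ} {μ : ℝ} {Z : Set E} {h : E → ℝ}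
    (hh : UniformlyConvex q μ Z h) (hμ : 0 ≤ μ) {z z' : E} (hz : z ∈ Z) (hz' : z' ∈ Z) :
    h z' + ⟪∇ h z', z - z'⟫ ≤ h z := by
  have h1 := hh z hz z' hz'
  have h2 : 0 ≤ μ / q * ‖z - z'‖ ^ q := by positivity
  linarith

/-- Jensen's inequality from the gradient inequalities at the combined point, where the linear terms
cancel. -/
theorem UniformlyConvex.map_combo_le {q : ℕ} {μ : ℝ} {Z : Set E} {h : E → ℝ}
    (hh : UniformlyConvex q μ Z h) (hμ : 0 ≤ μ) (hZ : Convex ℝ Z) {x y : E} (hx : x ∈ Z)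
    (hy : y ∈ Z) {α β : ℝ} (hα : 0 ≤ α) (hβ : 0 ≤ β) (hαβ : α + β = 1) :
    h (α • x + β • y) ≤ α * h x + β * h y := by
  have hz := hZ hx hy hα hβ hαβ
  set z := α • x + β • y with hzdef
  have h1 := mul_le_mul_of_nonneg_left (hh.add_inner_le hμ hx hz) hα
  have h2 := mul_le_mul_of_nonneg_left (hh.add_inner_le hμ hy hz) hβ
  have h3 : α * ⟪∇ h z, x - z⟫ + β * ⟪∇ h z, y - z⟫ = 0 := by
    have h4 : α • (x - z) + β • (y - z) = 0 := by
      have h5 : α • (x - z) + β • (y - z) = (α • x + β • y) - (α + β) • z := by module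
      rw [h5, hαβ, one_smul, hzdef, sub_self]
    rw [← real_inner_smul_right, ← real_inner_smul_right, ← inner_add_right, h4, inner_zero_right]
  have h4 : α * h z + β * h z = h z := by rw [← add_mul, hαβ, one_mul]
  linarith

theorem IsTensorProx.sub_le_inner {p q : ℕ} {M μ : ℝ} {Z : Set E} {h : E → ℝ} {zbar zt u z' : E}
    (hprox : IsTensorProx p M Z h zbar zt u) (hh : UniformlyConvex q μ Z h) (hμ : 0 ≤ μ)
    (hz' : z' ∈ Z) : h zt - h z' ≤ ⟪∇ h zt + u, zt - z'⟫ := by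
  obtain ⟨⟨hzt, hvi⟩, rfl⟩ := hprox
  have h1 := hh.add_inner_le hμ hz' hzt
  have h2 := hvi z' hz'
  rw [← neg_sub z' zt, inner_neg_right, inner_add_left, inner_neg_left]
  linarith

/-- Convexity at `zt`, tested against `z` with weight `A` and against `zstar` with weight `a'`,
yields inner products with `g` that regroup around `zbar` and `v`. The `v` part cancels against the
projection step. The remaining `(gam * a')² ‖g‖² / 2` is exactly what the equation for `a'` lets the
inner product with `zt - zbar` absorb. -/
theorem energy_step {p q : ℕ} {M μ : ℝ} {Z : Set E} {h : E → ℝ} (hZ : Convex ℝ Z)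
    (hh : UniformlyConvex q μ Z h) (hμ : 0 ≤ μ) {z v zbar zt u v' zstar : E}
    {A a' lam' gam κ : ℝ} (hprox : IsTensorProx p M Z h zbar zt u)
    (hz : z ∈ Z) (hstar : zstar ∈ Z) (hA : 0 ≤ A) (ha' : 0 < a')
    (hlam' : 0 < lam') (heq : A + a' = 2 * lam' * a' ^ 2)
    (hzbar : (A + a') • zbar = A • z + a' • v) (hgam : 0 < gam) (hgam1 : gam ≤ 1) (hκ : 0 ≤ κ)
    (hgamκ : gam * κ ≤ lam') (hg : ‖∇ h zt + u + (2 * κ) • (zt - zbar)‖ ≤ κ * ‖zt - zbar‖)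
    (hv' : IsProj Z (v - (gam * a') • (∇ h zt + u)) v') :
    (A + gam * a') * (h (((1 - gam) * A / (A + gam * a')) • z +
        (gam * (A + a') / (A + gam * a')) • zt) - h zstar) + 1 / 2 * ‖v' - zstar‖ ^ 2 +
      3 / 4 * (gam * (A + a') * κ * ‖zt - zbar‖ ^ 2) ≤
        A * (h z - h zstar) + 1 / 2 * ‖v - zstar‖ ^ 2 := by
  set g := ∇ h zt + u with hgdef
  have hA1 : 0 < A + gam * a' := by positivity
  have hgam2 : 0 ≤ 1 - gam := by linarith
  have hjensen := hh.map_combo_le hμ hZ hz hprox.1.1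
    (α := (1 - gam) * A / (A + gam * a')) (β := gam * (A + a') / (A + gam * a'))
    (by positivity) (by positivity) (by field_simp; ring)
  have h1 := mul_le_mul_of_nonneg_left hjensen hA1.le
  have h2 : (A + gam * a') * ((1 - gam) * A / (A + gam * a') * h z +
      gam * (A + a') / (A + gam * a') * h zt) = (1 - gam) * A * h z + gam * (A + a') * h zt := by
    field_simp
  rw [h2] at h1
  have h3 := mul_le_mul_of_nonneg_left (hprox.sub_le_inner hh hμ hz) hA
  have h4 := mul_le_mul_of_nonneg_left (hprox.sub_le_inner hh hμ hstar) ha'.le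
  rw [← hgdef] at h3 h4
  have h5 : A * ⟪g, zt - z⟫ + a' * ⟪g, zt - zstar⟫ =
      (A + a') * ⟪g, zt - zbar⟫ + a' * ⟪g, v - zstar⟫ := by
    have h6 := congrArg (fun x => ⟪g, x⟫) hzbar
    simp only [inner_add_right, real_inner_smul_right] at h6
    simp only [inner_sub_right]
    linear_combination h6
  have h6 := hv'.norm_sub_sq_le hZ hstar
  have h7 : ‖v - (gam * a') • g - zstar‖ ^ 2 =
      ‖v - zstar‖ ^ 2 - 2 * (gam * a') * ⟪g, v - zstar⟫ + (gam * a') ^ 2 * ‖g‖ ^ 2 := by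
    rw [sub_right_comm, norm_sub_sq_real, real_inner_smul_right, norm_smul, mul_pow,
      Real.norm_eq_abs, sq_abs, real_inner_comm]
    ring
  rw [h7] at h6
  have h8 := mul_le_mul_of_nonneg_left
    (inner_add_sq_le_of_norm_add_smul_le hκ hlam' hgamκ hg) (show 0 ≤ gam * (A + a') by positivity)
  have h9 : gam * (A + a') * (gam / (4 * lam') * ‖g‖ ^ 2) = 1 / 2 * ((gam * a') ^ 2 * ‖g‖ ^ 2) := by
    rw [heq]
    field_simp
    ring
  have h10 := mul_le_mul_of_nonneg_left (add_le_add h3 h4) hgam.le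
  rw [h5] at h10
  rw [mul_add, h9] at h8
  linarith

end Energy

/-! ### Invariants and outcome of a single iteration. -/

section Iteration

variable {E : Type*}

/-- The properties of the state at the beginning of iteration `t` that do not depend on `h`. -/
structure IterState.Valid (Z : Set E) (t : ℕ) (s : IterState E) : Prop where
  z_mem : s.z ∈ Z
  v_mem : s.v ∈ Z
  zt_mem : s.zt ∈ Z
  A_nonneg : 0 ≤ s.A
  lam'_nonneg : 0 ≤ s.lam'
  A_eq_zero : t = 0 → s.A = 0

theorem IterState.valid_init {Z : Set E} {z : E} (hz : z ∈ Z) :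
    (IterState.init z).Valid Z 0 :=
  ⟨hz, hz, hz, le_rfl, zero_le_one, fun _ => rfl⟩

/-- The energy of a state, which does not increase in the course of an epoch. -/
noncomputable def IterState.energy [NormedAddCommGroup E] (h : E → ℝ) (zstar : E)
    (s : IterState E) : ℝ :=
  s.A * (h s.z - h zstar) + 1 / 2 * ‖s.v - zstar‖ ^ 2

theorem IterState.energy_nonneg [NormedAddCommGroup E] {Z : Set E} {h : E → ℝ} {zstar : E}
    (hmin : IsMinOn h Z zstar) {t : ℕ} {s : IterState E} (hs : s.Valid Z t) : 0 ≤ s.energy h zstar := by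
  have h1 : 0 ≤ h s.z - h zstar := sub_nonneg.2 (hmin hs.z_mem)
  have h2 := hs.A_nonneg
  unfold IterState.energy
  positivity

variable [NormedAddCommGroup E] [InnerProductSpace ℝ E]

theorem IterState.Valid.combo_mem {Z : Set E} (hZ : Convex ℝ Z) {t : ℕ} {s : IterState E}
    (hs : s.Valid Z t) {a : ℝ} (ha : 0 < a) :
    (s.A / (s.A + a)) • s.z + (a / (s.A + a)) • s.v ∈ Z := by
  have hA := hs.A_nonneg
  exact hZ hs.z_mem hs.v_mem (by positivity) (by positivity) (by field_simp)

/-- The positive solution of the equation for `a'` is unique. -/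
theorem eq_of_add_eq_two_mul_sq {A lam a b : ℝ} (hA : 0 ≤ A) (ha : 0 < a) (hb : 0 < b)
    (h1 : A + a = 2 * lam * a ^ 2) (h2 : A + b = 2 * lam * b ^ 2) : a = b := by
  have h3 : 1 ≤ 2 * lam * a := by
    by_contra hcon
    push Not at hcon
    nlinarith
  have h4 : 1 ≤ 2 * lam * b := by
    by_contra hcon
    push Not at hcon
    nlinarith
  have h5 : (a - b) * (2 * lam * a + 2 * lam * b - 1) = 0 := by linear_combination h2 - h1
  rcases mul_eq_zero.1 h5 with h | h <;> linarith

theorem exists_add_eq_two_mul_sq {A lam : ℝ} (hA : 0 ≤ A) (hlam : 0 < lam) :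
    ∃ a : ℝ, 0 < a ∧ A + a = 2 * lam * a ^ 2 := by
  obtain ⟨x, hx, h1⟩ : ∃ x : ℝ, 0 ≤ x ∧ x ^ 2 = 1 + 8 * lam * A :=
    ⟨√(1 + 8 * lam * A), Real.sqrt_nonneg _, Real.sq_sqrt (by positivity)⟩
  refine ⟨(1 + x) / (4 * lam), by positivity, ?_⟩
  field_simp
  linear_combination (-2 : ℝ) * h1

variable [CompleteSpace E]

/-- The outcome of an iteration from a state that is not halted, in terms of the length `r` of the
tensor step and the value `lamp` of `λ'` in use, which is `lam` if `t = 0` and the guess otherwise. -/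
theorem IsIteration.cases {p : ℕ} (hp : 1 ≤ p) {L μ : ℝ} (hL : 0 < L) (hμ : 0 ≤ μ) {Z : Set E}
    (hZ : Convex ℝ Z) {h : E → ℝ} (hh : UniformlyConvex (p + 1) μ Z h)
    (hLip : LipschitzDerivOn p L Z h) {zstar : E} (hstar : zstar ∈ Z) {t : ℕ}
    {s s' : IterState E} (hs : s.Valid Z t) (hs0 : s.lam' ≠ 0)
    (hit : IsIteration p (2 * L) L Z h t s s') :
    s'.Valid Z (t + 1) ∧ s'.queries.length ≤ s.queries.length + 4 ∧
    ∃ r lam lamp : ℝ, 0 ≤ r ∧ lam = L * r ^ (p - 1) ∧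
      (lamp = if t = 0 then lam else s.lam') ∧
      ((lamp = 0 ∧ s'.lam' = 0 ∧ h s'.zt ≤ h zstar) ∨
      (0 < lamp ∧ ∃ a' gam : ℝ, 0 < a' ∧ s.A + a' = 2 * lamp * a' ^ 2 ∧
        (gam = if lam ≤ lamp then 1 else lamp / lam) ∧ 0 < gam ∧
        s'.A = s.A + gam * a' ∧
        (s'.lam' = if lam ≤ lamp then lamp / 2 else 2 * lamp) ∧
        s'.energy h zstar + 3 / 4 * (gam * (s.A + a') * (lam / (p ! : ℝ)) * r ^ 2) ≤
          s.energy h zstar)) := by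
  rw [IsIteration, if_neg hs0] at hit
  obtain ⟨a₀, zbar, zt, u, ha₀, heq₀, hzbar, hprox, hit⟩ := hit
  have hA := hs.A_nonneg
  have hzbarZ : zbar ∈ Z := hzbar ▸ hs.combo_mem hZ ha₀
  have hg := hprox.norm_add_smul_le hp hZ hLip hzbarZ
  simp only at hit
  set r := ‖zt - zbar‖ with hr
  set lam := L * r ^ (p - 1) with hlam
  have hr0 : 0 ≤ r := norm_nonneg _
  have hlam0 : 0 ≤ lam := by positivity
  set lamp := if t = 0 then lam else s.lam' with hlamp
  have hlamp0 : 0 ≤ lamp := by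
    rw [hlamp]
    split_ifs
    exacts [hlam0, hs.lam'_nonneg]
  by_cases hzero : lamp = 0
  · rw [if_pos hzero] at hit
    subst hit
    refine ⟨⟨hprox.1.1, hs.v_mem, hprox.1.1, hA, le_rfl, by simp⟩, by simp,
      r, lam, lamp, hr0, rfl, rfl, Or.inl ⟨hzero, rfl, ?_⟩⟩
    -- Only the replaced guess of the first iteration can vanish. It vanishes only if the tensor
    -- step has length zero; then `g = 0`, and `zt` is a minimizer.
    have ht : t = 0 := by
      by_contra ht
      rw [hlamp, if_neg ht] at hzero
      exact hs0 hzero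
    rw [hlamp, if_pos ht] at hzero
    have hr00 : r = 0 := by
      rcases mul_eq_zero.1 hzero with h0 | h0
      · exact absurd h0 hL.ne'
      · by_contra hne
        exact pow_ne_zero _ hne h0
    have hg0 : ∇ h zt + u = 0 := by
      rw [hr00, mul_zero, hzero, zero_div, mul_zero, zero_smul, add_zero] at hg
      exact norm_le_zero_iff.1 hg
    have h1 := hprox.sub_le_inner hh hμ hstar
    rw [hg0, inner_zero_left] at h1
    simp only
    linarith
  · rw [if_neg hzero] at hit
    obtain ⟨a', v', ha', heq, hv', hs'⟩ := hit
    have hlamppos : 0 < lamp := lt_of_le_of_ne hlamp0 (Ne.symm hzero)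
    set gam := if lam ≤ lamp then 1 else lamp / lam with hgam
    have hgamcases : 0 < gam ∧ gam ≤ 1 ∧ gam * lam ≤ lamp := by
      rw [hgam]
      split_ifs with hle
      · exact ⟨one_pos, le_rfl, by linarith⟩
      · push Not at hle
        have hlampos : 0 < lam := hlamppos.trans hle
        refine ⟨by positivity, (div_le_one hlampos).2 hle.le, ?_⟩
        rw [div_mul_cancel₀ _ hlampos.ne']
    obtain ⟨hgam0, hgam1, hgamlam⟩ := hgamcases
    have hfac : (1 : ℝ) ≤ (p ! : ℝ) := by exact_mod_cast Nat.one_le_iff_ne_zero.2 p.factorial_ne_zero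
    have hκ : lam / (p ! : ℝ) ≤ lam := div_le_self hlam0 hfac
    have hzbar' : (s.A + a') • zbar = s.A • s.z + a' • s.v := by
      -- The point `zbar` was formed with `a₀` rather than `a'`. At `t = 0` this is harmless because
      -- `A = 0`; later both solve the same equation, whose positive root is unique.
      by_cases ht : t = 0
      · have hA0 := hs.A_eq_zero ht
        rw [hzbar, hA0]
        simp [div_self ha₀.ne']
      · have haa : a' = a₀ := by
          rw [hlamp, if_neg ht] at heq
          exact eq_of_add_eq_two_mul_sq hA ha' ha₀ heq heq₀
        have hne : s.A + a₀ ≠ 0 := by positivity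
        rw [haa, hzbar, smul_add, smul_smul, smul_smul, mul_div_cancel₀ _ hne,
          mul_div_cancel₀ _ hne]
    have hen := energy_step hZ hh hμ hprox hs.z_mem hstar hA ha' hlamppos heq hzbar' hgam0 hgam1
      (κ := lam / (p ! : ℝ)) (by positivity)
      ((mul_le_mul_of_nonneg_left hκ hgam0.le).trans hgamlam) hg hv'
    subst hs'
    have hA1 : 0 < s.A + gam * a' := by positivity
    refine ⟨⟨hZ hs.z_mem hprox.1.1 ?_ (by positivity) (by field_simp; ring), hv'.1, hprox.1.1,
      hA1.le, ?_, by simp⟩, by simp, r, lam, lamp, hr0, rfl, rfl,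
      Or.inr ⟨hlamppos, a', gam, ha', heq, rfl, hgam0, rfl, rfl, hen⟩⟩
    · have : 0 ≤ 1 - gam := by linarith
      positivity
    · simp only
      split_ifs <;> linarith

theorem IsIteration.eq_of_halted {p : ℕ} {M γ : ℝ} {Z : Set E} {h : E → ℝ} {t : ℕ}
    {s s' : IterState E} (hit : IsIteration p M γ Z h t s s') (hs : s.lam' = 0) : s' = s := by
  rwa [IsIteration, if_pos hs] at hit

theorem IsIteration.valid {p : ℕ} (hp : 1 ≤ p) {L μ : ℝ} (hL : 0 < L) (hμ : 0 ≤ μ) {Z : Set E}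
    (hZ : Convex ℝ Z) {h : E → ℝ} (hh : UniformlyConvex (p + 1) μ Z h)
    (hLip : LipschitzDerivOn p L Z h) {t : ℕ} {s s' : IterState E} (hs : s.Valid Z t)
    (hit : IsIteration p (2 * L) L Z h t s s') :
    s'.Valid Z (t + 1) ∧ s'.queries.length ≤ s.queries.length + 4 := by
  by_cases hs0 : s.lam' = 0
  · rw [hit.eq_of_halted hs0]
    exact ⟨{ hs with A_eq_zero := by simp }, by omega⟩
  · have h1 := hit.cases hp hL hμ hZ hh hLip hs.z_mem hs hs0
    exact ⟨h1.1, h1.2.1⟩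

theorem exists_isIteration [ProperSpace E] {p : ℕ} (hp : 1 ≤ p) {L : ℝ} (hL : 0 < L) {Z : Set E}
    (hZc : IsClosed Z) (hZ : Convex ℝ Z) {h : E → ℝ}
    (hLip : LipschitzDerivOn p L Z h) {t : ℕ} {s : IterState E} (hs : s.Valid Z t) :
    ∃ s', IsIteration p (2 * L) L Z h t s s' := by
  by_cases hs0 : s.lam' = 0
  · exact ⟨s, by rw [IsIteration, if_pos hs0]⟩
  · obtain ⟨a₀, ha₀, heq₀⟩ := exists_add_eq_two_mul_sq hs.A_nonneg
      (lt_of_le_of_ne hs.lam'_nonneg (Ne.symm hs0))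
    have hzbar := hs.combo_mem hZ ha₀
    set zbar := (s.A / (s.A + a₀)) • s.z + (a₀ / (s.A + a₀)) • s.v with hzb
    obtain ⟨zt, hzt⟩ := exists_isTensorStep hp hZc hZ (M := 2 * L) (by positivity) hzbar
      (hLip.1 _ hzbar)
    set lam := L * ‖zt - zbar‖ ^ (p - 1) with hlam
    set lamp := if t = 0 then lam else s.lam' with hlamp
    have hlamp0 : 0 ≤ lamp := by
      rw [hlamp]
      split_ifs
      · positivity
      · exact hs.lam'_nonneg
    simp only [IsIteration, if_neg hs0]
    by_cases hzero : lamp = 0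
    · exact ⟨_, a₀, zbar, zt, _, ha₀, heq₀, hzb, ⟨hzt, rfl⟩, (if_pos hzero).mpr rfl⟩
    · obtain ⟨a', ha', heq⟩ := exists_add_eq_two_mul_sq hs.A_nonneg
        (lt_of_le_of_ne hlamp0 (Ne.symm hzero))
      obtain ⟨v', hv'⟩ := exists_isProj hZc hZ ⟨_, hzbar⟩
        (s.v - ((if lam ≤ lamp then 1 else lamp / lam) * a') •
          (∇ h zt + -regularizedModel p (∇ h) (2 * L) zbar zt))
      exact ⟨_, a₀, zbar, zt, _, ha₀, heq₀, hzb, ⟨hzt, rfl⟩,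
        (if_neg hzero).mpr ⟨a', v', ha', heq, hv', rfl⟩⟩

end Iteration

/-! ### Epochs, restarts and the halving of the gap. -/

section Epoch

variable {E : Type*} [NormedAddCommGroup E] [InnerProductSpace ℝ E] [CompleteSpace E]

theorem valid_of_isIteration {p : ℕ} (hp : 1 ≤ p) {L μ : ℝ} (hL : 0 < L) (hμ : 0 ≤ μ) {Z : Set E}
    (hZ : Convex ℝ Z) {h : E → ℝ} (hh : UniformlyConvex (p + 1) μ Z h)
    (hLip : LipschitzDerivOn p L Z h) {T : ℕ} {z : E} (hz : z ∈ Z) {st : ℕ → IterState E}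
    (h0 : st 0 = IterState.init z)
    (hit : ∀ t < T, IsIteration p (2 * L) L Z h t (st t) (st (t + 1))) :
    ∀ t ≤ T, (st t).Valid Z t ∧ (st t).queries.length ≤ 4 * t := by
  intro t ht
  induction t with
  | zero =>
    rw [h0]
    exact ⟨IterState.valid_init hz, by simp [IterState.init]⟩
  | succ t ih =>
    obtain ⟨h1, h2⟩ := ih (by omega)
    obtain ⟨h3, h4⟩ := (hit t (by omega)).valid hp hL hμ hZ hh hLip h1
    exact ⟨h3, by omega⟩

/-- Factor `a = Y' - Y` as a difference of squares, bound `√Y + √Y'` by `2 √Y'`, and use `√Y' = √lam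
* a`. -/
theorem sqrt_add_le_sqrt_of_eq_mul_sq {lam Y Y' a : ℝ} (hlam : 0 < lam) (hY : 0 ≤ Y) (ha : 0 < a)
    (h1 : Y' = Y + a) (h2 : Y' = lam * a ^ 2) : √Y + 1 / (2 * √lam) ≤ √Y' := by
  have hl : 0 < √lam := Real.sqrt_pos.2 hlam
  have h3 : √Y' = √lam * a := by rw [h2, Real.sqrt_mul hlam.le, Real.sqrt_sq ha.le]
  have h4 : 1 / (2 * √lam) = a / (2 * √Y') := by
    rw [h3]
    field_simp
  have hY' : 0 < √Y' := by rw [h3]; positivity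
  have h5 : √Y ≤ √Y' := Real.sqrt_le_sqrt (by linarith)
  have h6 : a = (√Y' - √Y) * (√Y' + √Y) := by
    have h7 := Real.sq_sqrt hY
    have h8 := Real.sq_sqrt (show 0 ≤ Y' by linarith)
    linear_combination -h1 + h7 - h8
  have h9 : a / (2 * √Y') ≤ √Y' - √Y := by
    rw [div_le_iff₀ (by positivity)]
    nlinarith [mul_nonneg (sub_nonneg.2 h5) (sub_nonneg.2 h5)]
  linarith

/-- The dichotomy for the iterations after the first one, in terms of the change of the guess. -/
theorem IsIteration.step_cases {p : ℕ} (hp : 1 ≤ p) {L μ : ℝ} (hL : 0 < L) (hμ : 0 ≤ μ)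
    {Z : Set E} (hZ : Convex ℝ Z) {h : E → ℝ} (hh : UniformlyConvex (p + 1) μ Z h)
    (hLip : LipschitzDerivOn p L Z h) {zstar : E} (hstar : zstar ∈ Z) {t : ℕ} (ht : t ≠ 0)
    {s s' : IterState E} (hs : s.Valid Z t) (hs0 : 0 < s.lam')
    (hit : IsIteration p (2 * L) L Z h t s s') :
    0 < s'.lam' ∧ s.A ≤ s'.A ∧ s'.energy h zstar ≤ s.energy h zstar ∧
    ((s'.lam' = s.lam' / 2 ∧ ∃ a : ℝ, 0 < a ∧ s'.A = s.A + a ∧ s'.A = 2 * s.lam' * a ^ 2) ∨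
     (s'.lam' = 2 * s.lam' ∧ ∃ r : ℝ, 0 ≤ r ∧ s.lam' ≤ L * r ^ (p - 1) ∧
        3 / 4 * (s.A * s.lam' * r ^ 2) ≤
          (p ! : ℝ) * (s.energy h zstar - s'.energy h zstar))) := by
  obtain ⟨-, -, r, lam, lamp, hr, hlam, hlamp, hcase⟩ :=
    hit.cases hp hL hμ hZ hh hLip hstar hs hs0.ne'
  rw [if_neg ht] at hlamp
  subst hlamp
  rcases hcase with ⟨hzero, -⟩ | ⟨-, a', gam, ha', heq, hgam, hgam0, hA', hlam', hen⟩
  · exact absurd hzero hs0.ne'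
  have hA := hs.A_nonneg
  have hlam0 : 0 ≤ lam := by rw [hlam]; positivity
  have hfac : (0 : ℝ) < (p ! : ℝ) := by positivity
  have hloss : 0 ≤ gam * (s.A + a') * (lam / (p ! : ℝ)) * r ^ 2 := by positivity
  have hAle : s.A ≤ s'.A := by
    rw [hA']
    have : 0 < gam * a' := by positivity
    linarith
  refine ⟨?_, hAle, by linarith, ?_⟩
  · rw [hlam']
    split_ifs <;> linarith
  · by_cases hle : lam ≤ s.lam'
    · rw [if_pos hle] at hgam hlam'
      subst hgam
      rw [one_mul] at hA'
      exact Or.inl ⟨hlam', a', ha', hA', hA'.trans heq⟩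
    · rw [if_neg hle] at hgam hlam'
      push Not at hle
      have hlampos : 0 < lam := hs0.trans hle
      refine Or.inr ⟨hlam', r, hr, hlam ▸ hle.le, ?_⟩
      -- In the doubling case `gam * lam` equals the guess, so damping leaves a loss proportional to
      -- the guess.
      have h1 : gam * (s.A + a') * (lam / (p ! : ℝ)) * r ^ 2 =
          (s.A + a') * s.lam' * r ^ 2 / (p ! : ℝ) := by
        rw [hgam]
        field_simp
      have h2 : s.A * s.lam' * r ^ 2 ≤ (s.A + a') * s.lam' * r ^ 2 := by
        gcongr
        linarith
      rw [h1] at hen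
      have h3 : 3 / 4 * ((s.A + a') * s.lam' * r ^ 2 / (p ! : ℝ)) ≤
          s.energy h zstar - s'.energy h zstar := by linarith
      have h4 := mul_le_mul_of_nonneg_left h3 hfac.le
      have h5 : (p ! : ℝ) * (3 / 4 * ((s.A + a') * s.lam' * r ^ 2 / (p ! : ℝ))) =
          3 / 4 * ((s.A + a') * s.lam' * r ^ 2) := by field_simp
      linarith

/-- The first iteration either finds a minimizer or sets a guess of the right order. -/
theorem IsIteration.first_cases {p : ℕ} (hp : 1 ≤ p) {L μ : ℝ} (hL : 0 < L) (hμ : 0 ≤ μ)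
    {Z : Set E} (hZ : Convex ℝ Z) {h : E → ℝ} (hh : UniformlyConvex (p + 1) μ Z h)
    (hLip : LipschitzDerivOn p L Z h) {zstar : E} (hstar : zstar ∈ Z) (hmin : IsMinOn h Z zstar)
    {z : E} (hz : z ∈ Z) {s : IterState E}
    (hit : IsIteration p (2 * L) L Z h 0 (IterState.init z) s) :
    h s.zt ≤ h zstar ∨ (0 < s.lam' ∧ s.A * s.lam' = 1 / 4 ∧
      s.energy h zstar ≤ 1 / 2 * ‖z - zstar‖ ^ 2 ∧
      2 * s.lam' ≤ L * (2 * (p ! : ℝ) * ‖z - zstar‖) ^ (p - 1)) := by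
  obtain ⟨hvalid, -, r, lam, lamp, hr, hlam, hlamp, hcase⟩ :=
    hit.cases hp hL hμ hZ hh hLip hstar (IterState.valid_init hz)
      (show (1 : ℝ) ≠ 0 from one_ne_zero)
  rw [if_pos rfl] at hlamp
  subst hlamp
  rcases hcase with ⟨-, -, hzt⟩ | ⟨hlam0, a', gam, ha', heq, hgam, hgam0, hA', hlam', hen⟩
  · exact Or.inl hzt
  right
  rw [if_pos le_rfl] at hgam hlam'
  subst hgam
  have hinit : (IterState.init z).energy h zstar = 1 / 2 * ‖z - zstar‖ ^ 2 := by
    simp [IterState.energy, IterState.init]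
  have hA0 : (IterState.init z).A = 0 := rfl
  rw [hinit, hA0] at hen
  rw [hA0, zero_add] at heq hA'
  have ha1 : a' * lamp = 1 / 2 := by
    have h1 : a' * (2 * (a' * lamp) - 1) = 0 := by linear_combination -heq
    rcases mul_eq_zero.1 h1 with h2 | h2 <;> linarith
  have hfac : (1 : ℝ) ≤ (p ! : ℝ) := by exact_mod_cast Nat.one_le_iff_ne_zero.2 p.factorial_ne_zero
  have hfac0 : (0 : ℝ) < (p ! : ℝ) := by linarith
  have hloss : 1 * (0 + a') * (lamp / (p ! : ℝ)) * r ^ 2 = 1 / 2 * r ^ 2 / (p ! : ℝ) := by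
    rw [← ha1]
    ring
  rw [hloss] at hen
  have hloss0 : 0 ≤ 1 / 2 * r ^ 2 / (p ! : ℝ) := by positivity
  refine ⟨by linarith, ?_, by linarith, ?_⟩
  · rw [hA', hlam']
    linear_combination (1 / 2 : ℝ) * ha1
  · rw [hlam', mul_div_cancel₀ _ two_ne_zero, hlam]
    gcongr
    have h1 := IterState.energy_nonneg hmin hvalid
    have h2 : 3 / 4 * (1 / 2 * r ^ 2 / (p ! : ℝ)) ≤ 1 / 2 * ‖z - zstar‖ ^ 2 := by linarith
    -- The loss in the first iteration cannot exceed the initial energy, so `r² ≤ (4/3) p! R²`; the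
    -- cruder `r ≤ 2 p! R` is the length scale used from here on.
    have h3 : 3 / 4 * r ^ 2 ≤ (p ! : ℝ) * ‖z - zstar‖ ^ 2 := by
      have h4 := mul_le_mul_of_nonneg_left h2 hfac0.le
      have h5 : (p ! : ℝ) * (3 / 4 * (1 / 2 * r ^ 2 / (p ! : ℝ))) = 3 / 8 * r ^ 2 := by
        field_simp
        ring
      linarith
    refine (sq_le_sq₀ hr (by positivity)).1 ?_
    have h4 : (p ! : ℝ) * ‖z - zstar‖ ^ 2 ≤ (p ! : ℝ) ^ 2 * ‖z - zstar‖ ^ 2 := by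
      gcongr
      nlinarith
    nlinarith [sq_nonneg r]

/-- In an epoch of `n + 1` iterations that does not find a minimizer in the first one, the weight
`A` becomes large, and the energy is controlled. -/
theorem weight_growth {p : ℕ} (hp : 1 ≤ p) {b L μ : ℝ} (hb : b = 2 / (3 * p + 1)) (hL : 0 < L)
    (hμ : 0 ≤ μ) {Z : Set E} (hZ : Convex ℝ Z) {h : E → ℝ} (hh : UniformlyConvex (p + 1) μ Z h)
    (hLip : LipschitzDerivOn p L Z h) {zstar : E} (hstar : zstar ∈ Z) (hmin : IsMinOn h Z zstar)
    {n : ℕ} {z : E} (hz : z ∈ Z) (hne : z ≠ zstar) {st : ℕ → IterState E}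
    (h0 : st 0 = IterState.init z)
    (hit : ∀ t < n + 1, IsIteration p (2 * L) L Z h t (st t) (st (t + 1)))
    (hzt : h zstar < h (st 1).zt) :
    0 < (st (n + 1)).A ∧ (st (n + 1)).energy h zstar ≤ 1 / 2 * ‖z - zstar‖ ^ 2 ∧
      (n + 1 : ℝ) ≤ (5 + 8 / b) *
        (2 * (L * (2 * (p ! : ℝ) * ‖z - zstar‖) ^ (p - 1)) * (st (n + 1)).A) ^ b := by
  have hvalid := valid_of_isIteration hp hL hμ hZ hh hLip hz h0 hit
  have hR : 0 < ‖z - zstar‖ := norm_pos_iff.2 (sub_ne_zero.2 hne)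
  have hfac : (1 : ℝ) ≤ (p ! : ℝ) := by exact_mod_cast Nat.one_le_iff_ne_zero.2 p.factorial_ne_zero
  have hfac0 : (0 : ℝ) < (p ! : ℝ) := by linarith
  set R := ‖z - zstar‖ with hRdef
  set R' := 2 * (p ! : ℝ) * R with hR'
  have hR'0 : 0 < R' := by positivity
  set G := L * R' ^ (p - 1) with hG
  have hG0 : 0 < G := by positivity
  have hfirst := (h0 ▸ hit 0 (by omega) : IsIteration p (2 * L) L Z h 0 (IterState.init z)
    (st (0 + 1))).first_cases hp hL hμ hZ hh hLip hstar hmin hz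
  obtain ⟨hl1, hAl, hE1, hlG⟩ := hfirst.resolve_left (not_le.2 hzt)
  rw [zero_add] at hl1 hAl hE1 hlG
  have hpos : ∀ t ≤ n, 0 < (st (t + 1)).lam' := by
    intro t ht
    induction t with
    | zero => exact hl1
    | succ t ih =>
      exact ((hit (t + 1) (by omega)).step_cases hp hL hμ hZ hh hLip hstar (by omega)
        (hvalid (t + 1) (by omega)).1 (ih (by omega))).1
  have hstep : ∀ t < n, _ := fun t ht =>
    ((hit (t + 1) (by omega)).step_cases hp hL hμ hZ hh hLip hstar (by omega)
      (hvalid (t + 1) (by omega)).1 (hpos t (by omega))).2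
  have hA1 : 0 < (st 1).A := by
    by_contra hcon
    push Not at hcon
    nlinarith
  have hAE : ∀ t ≤ n, (st 1).A ≤ (st (t + 1)).A ∧
      (st (t + 1)).energy h zstar ≤ (st 1).energy h zstar := by
    intro t ht
    induction t with
    | zero => exact ⟨le_rfl, le_rfl⟩
    | succ t ih =>
      obtain ⟨h1, h2⟩ := ih (by omega)
      obtain ⟨h3, h4, -⟩ := hstep t (by omega)
      exact ⟨h1.trans h3, h4.trans h2⟩
  obtain ⟨hAn, hEn⟩ := hAE n le_rfl
  refine ⟨hA1.trans_le hAn, hEn.trans hE1, ?_⟩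
  have hc : (0 : ℝ) < 2 / (3 * (p ! : ℝ) * R ^ 2) := by positivity
  -- Index `t` stands for state `t + 1`, since the guess is meaningful only after the first
  -- iteration. Lengths are measured in units of `R'` and guesses in units of `G`. The factor of the
  -- energy is the one that turns the loss bound of `step_cases` into the required form.
  refine succ_le_mul_rpow_of_halving_doubling hp hb
    (Y := fun t => 2 * G * (st (t + 1)).A) (lam := fun t => (st (t + 1)).lam' / G)
    (en := fun t => 2 / (3 * (p ! : ℝ) * R ^ 2) * (st (t + 1)).energy h zstar)
    ?_ (by simp only [zero_add]; positivity) ?_ ?_ ?_ ?_ ?_ ?_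
  · simp only [zero_add]
    have h1 : 2 * (2 * (st 1).lam') * (st 1).A ≤ 2 * G * (st 1).A := by gcongr
    nlinarith
  · simp only [zero_add]
    field_simp
    linear_combination 4 * hAl
  · intro t ht
    have := (hstep t ht).1
    gcongr
  · simp only [zero_add]
    calc 2 / (3 * (p ! : ℝ) * R ^ 2) * (st 1).energy h zstar
        ≤ 2 / (3 * (p ! : ℝ) * R ^ 2) * (1 / 2 * R ^ 2) := by gcongr
      _ = 1 / (3 * (p ! : ℝ)) := by field_simp
      _ ≤ 1 := by
        rw [div_le_one (by positivity)]
        linarith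
  · exact mul_nonneg hc.le (IterState.energy_nonneg hmin (hvalid (n + 1) le_rfl).1)
  · intro t ht
    exact mul_le_mul_of_nonneg_left (hstep t ht).2.1 hc.le
  · intro t ht
    obtain ⟨-, -, hcase⟩ := hstep t ht
    have hlt := hpos t ht.le
    have hA := (hvalid (t + 1) (by omega)).1.A_nonneg
    rcases hcase with ⟨hhalf, a, ha, hadd, hsq⟩ | ⟨hdouble, r, hr, hlr, hloss⟩
    · left
      refine ⟨by simp only [hhalf]; ring, ?_⟩
      refine sqrt_add_le_sqrt_of_eq_mul_sq (a := 2 * G * a) (by positivity) (by positivity)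
        (by positivity) (by simp only [hadd]; ring) ?_
      simp only [hsq]
      field_simp
    · right
      refine ⟨by simp only [hdouble]; ring, r / R', by positivity, ?_, ?_⟩
      · rw [hG, div_pow, div_le_div_iff₀ (by positivity) (by positivity)]
        nlinarith [pow_pos hR'0 (p - 1)]
      · have h1 : 2 * G * (st (t + 1)).A * ((st (t + 1)).lam' / G) * (r / R') ^ 2 =
            2 / (3 * (p ! : ℝ) ^ 2 * R ^ 2) *
              (3 / 4 * ((st (t + 1)).A * (st (t + 1)).lam' * r ^ 2)) := by
          rw [hR']
          field_simp
          ring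
        have h2 : 2 / (3 * (p ! : ℝ) * R ^ 2) * (st (t + 1)).energy h zstar -
            2 / (3 * (p ! : ℝ) * R ^ 2) * (st (t + 1 + 1)).energy h zstar =
            2 / (3 * (p ! : ℝ) ^ 2 * R ^ 2) * ((p ! : ℝ) *
              ((st (t + 1)).energy h zstar - (st (t + 1 + 1)).energy h zstar)) := by
          field_simp
        simp only [h1, h2]
        gcongr

/-- At the minimizer the linear term of the uniform convexity inequality is nonnegative by
first-order optimality. -/
theorem UniformlyConvex.norm_pow_le {p : ℕ} (hp : 1 ≤ p) {μ L : ℝ} (hμ : 0 < μ) {Z : Set E}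
    (hZ : Convex ℝ Z) {h : E → ℝ} (hh : UniformlyConvex (p + 1) μ Z h)
    (hLip : LipschitzDerivOn p L Z h) {z zstar : E} (hstar : zstar ∈ Z)
    (hmin : IsMinOn h Z zstar) (hz : z ∈ Z) :
    ‖z - zstar‖ ^ (p + 1) ≤ (p + 1) / μ * (h z - h zstar) := by
  have h1 := hh z hz zstar hstar
  have hd : DifferentiableAt ℝ h zstar :=
    (hLip.1 zstar hstar).differentiableAt (by exact_mod_cast (show p ≠ 0 by omega))
  have h2 := hmin.fderiv_nonneg_of_convex hZ hd.hasFDerivAt hstar hz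
  rw [← inner_gradient_eq_fderiv] at h2
  have h3 : μ / (p + 1 : ℕ) * ‖z - zstar‖ ^ (p + 1) ≤ h z - h zstar := by linarith
  calc ‖z - zstar‖ ^ (p + 1) = (p + 1) / μ * (μ / (p + 1 : ℕ) * ‖z - zstar‖ ^ (p + 1)) := by
        push_cast
        field_simp
    _ ≤ _ := by gcongr

theorem IsEpoch.mem_and_le {p : ℕ} (hp : 1 ≤ p) {L μ : ℝ} (hL : 0 < L) (hμ : 0 ≤ μ) {Z : Set E}
    (hZ : Convex ℝ Z) {h : E → ℝ} (hh : UniformlyConvex (p + 1) μ Z h)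
    (hLip : LipschitzDerivOn p L Z h) {T : ℕ} {z zout : E} {qs : List E} (hz : z ∈ Z)
    (hep : IsEpoch p (2 * L) L Z h T z zout qs) :
    zout ∈ Z ∧ qs.length ≤ 4 * T + 2 ∧ ∃ st : ℕ → IterState E, st 0 = IterState.init z ∧
      (∀ t < T, IsIteration p (2 * L) L Z h t (st t) (st (t + 1))) ∧
      ∀ t ≤ T, h zout ≤ h (st t).z ∧ h zout ≤ h (st t).zt := by
  obtain ⟨st, h0, hit, ⟨i, hi, j, hj, hmini, hminj, hout⟩, hqs⟩ := hep
  have hvalid := valid_of_isIteration hp hL hμ hZ hh hLip hz h0 hit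
  refine ⟨?_, ?_, st, h0, hit, fun t ht => ?_⟩
  · rw [hout]
    split_ifs
    exacts [(hvalid i hi).1.z_mem, (hvalid j hj).1.zt_mem]
  · have := (hvalid T le_rfl).2
    rw [hqs, List.length_append]
    simp only [List.length_cons, List.length_nil]
    omega
  · have h1 := hmini t ht
    have h2 := hminj t ht
    rw [hout]
    split_ifs with hlt
    · exact ⟨h1, by linarith⟩
    · exact ⟨by linarith, h2⟩

/-- The factor `c` in the number of iterations of an epoch. -/
noncomputable def epochConstant (p : ℕ) : ℝ :=
  (5 + 4 * (3 * p + 1)) * (2 * (p + 1) * (2 * (p ! : ℝ)) ^ (p - 1)) ^ ((2 : ℝ) / (3 * p + 1))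

theorem epochConstant_pos (p : ℕ) : 0 < epochConstant p := by
  unfold epochConstant
  positivity

/-- A sufficiently long epoch halves the gap. -/
theorem IsEpoch.sub_le_half {p : ℕ} (hp : 1 ≤ p) {L μ : ℝ} (hL : 0 < L) (hμ : 0 < μ) {Z : Set E}
    (hZ : Convex ℝ Z) {h : E → ℝ} (hh : UniformlyConvex (p + 1) μ Z h)
    (hLip : LipschitzDerivOn p L Z h) {zstar : E} (hstar : zstar ∈ Z) (hmin : IsMinOn h Z zstar)
    {T : ℕ} (hT : epochConstant p * (L / μ) ^ ((2 : ℝ) / (3 * p + 1)) ≤ T) {z zout : E}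
    {qs : List E} (hz : z ∈ Z) (hep : IsEpoch p (2 * L) L Z h T z zout qs) :
    h zout - h zstar ≤ 1 / 2 * (h z - h zstar) := by
  obtain ⟨hout, -, st, h0, hit, hle⟩ := hep.mem_and_le hp hL hμ.le hZ hh hLip hz
  have hgap : 0 ≤ h z - h zstar := sub_nonneg.2 (hmin hz)
  have hTpos : 0 < (T : ℝ) := lt_of_lt_of_le
    (mul_pos (epochConstant_pos p) (Real.rpow_pos_of_pos (div_pos hL hμ) _)) hT
  obtain ⟨n, rfl⟩ : ∃ n, T = n + 1 := ⟨T - 1, by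
    have : 0 < T := by exact_mod_cast hTpos
    omega⟩
  -- Growth is measured in units of `R > 0`, so a start at the minimizer is treated apart; so is an
  -- epoch whose first tensor step already reaches the minimum, which covers the halted case.
  by_cases hne : z = zstar
  · have h1 := (hle 0 (by omega)).1
    rw [h0] at h1
    have h2 : h zout ≤ h z := h1
    subst hne
    linarith
  by_cases hzt : h (st 1).zt ≤ h zstar
  · have h1 := (hle 1 (by omega)).2
    linarith
  push Not at hzt
  obtain ⟨hA, hE, hgrow⟩ := weight_growth hp rfl hL hμ.le hZ hh hLip hstar hmin hz hne h0 hit hzt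
  have hR : 0 < ‖z - zstar‖ := norm_pos_iff.2 (sub_ne_zero.2 hne)
  have hpow := hh.norm_pow_le hp hμ hZ hLip hstar hmin hz
  set R := ‖z - zstar‖ with hRdef
  set A := (st (n + 1)).A with hAdef
  set b : ℝ := 2 / (3 * p + 1) with hb
  have hb0 : 0 < b := by rw [hb]; positivity
  have hK : 5 + 8 / b = 5 + 4 * (3 * p + 1 : ℝ) := by
    rw [hb]
    field_simp
    ring
  set F := (2 * (p ! : ℝ)) ^ (p - 1) with hF
  have hF0 : 0 < F := by positivity
  -- Cancelling `5 + 8 / b` and the exponent `b` in the growth bound; `epochConstant` is defined to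
  -- leave exactly `(p + 1) / μ ≤ R ^ (p - 1) * A`.
  have h1 : 2 * (p + 1) * F * (L / μ) ≤ 2 * (L * (2 * (p ! : ℝ) * R) ^ (p - 1)) * A := by
    have h2 : (2 * (p + 1) * F * (L / μ)) ^ b ≤
        (2 * (L * (2 * (p ! : ℝ) * R) ^ (p - 1)) * A) ^ b := by
      rw [Real.mul_rpow (by positivity) (by positivity)]
      rw [hK] at hgrow
      have h3 : epochConstant p = (5 + 4 * (3 * p + 1 : ℝ)) * (2 * (p + 1) * F) ^ b := rfl
      rw [h3] at hT
      push_cast at hT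
      have h4 := hT.trans hgrow
      rw [mul_assoc] at h4
      exact le_of_mul_le_mul_left h4 (by positivity)
    exact (Real.rpow_le_rpow_iff (by positivity) (by positivity) hb0).1 h2
  rw [mul_pow, ← hF] at h1
  have h2 : (p + 1) / μ ≤ R ^ (p - 1) * A := by
    have h3 : (2 * F * L) * ((p + 1) / μ) ≤ (2 * F * L) * (R ^ (p - 1) * A) := by
      calc (2 * F * L) * ((p + 1) / μ) = 2 * (p + 1) * F * (L / μ) := by ring
        _ ≤ _ := h1
        _ = _ := by ring
    exact le_of_mul_le_mul_left h3 (by positivity)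
  have h3 : A * (h zout - h zstar) ≤ 1 / 2 * R ^ 2 := by
    have h4 := (hle (n + 1) le_rfl).1
    have h5 : A * (h zout - h zstar) ≤ A * (h (st (n + 1)).z - h zstar) := by gcongr
    have h6 : 0 ≤ 1 / 2 * ‖(st (n + 1)).v - zstar‖ ^ 2 := by positivity
    unfold IterState.energy at hE
    linarith
  have hRp : R ^ (p + 1) = R ^ (p - 1) * R ^ 2 := by
    rw [← pow_add]
    congr 1
    omega
  rw [hRp] at hpow
  have h4 : (R ^ (p - 1) * A) * (h zout - h zstar) ≤
      (R ^ (p - 1) * A) * (1 / 2 * (h z - h zstar)) := by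
    have h5 : 0 < R ^ (p - 1) := by positivity
    calc (R ^ (p - 1) * A) * (h zout - h zstar) = R ^ (p - 1) * (A * (h zout - h zstar)) := by ring
      _ ≤ R ^ (p - 1) * (1 / 2 * R ^ 2) := by gcongr
      _ = 1 / 2 * (R ^ (p - 1) * R ^ 2) := by ring
      _ ≤ 1 / 2 * ((p + 1) / μ * (h z - h zstar)) := by gcongr
      _ ≤ 1 / 2 * ((R ^ (p - 1) * A) * (h z - h zstar)) := by gcongr
      _ = _ := by ring
  exact le_of_mul_le_mul_left h4 (by positivity)

theorem exists_isEpoch [ProperSpace E] {p : ℕ} (hp : 1 ≤ p) {L μ : ℝ} (hL : 0 < L) (hμ : 0 ≤ μ)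
    {Z : Set E} (hZc : IsClosed Z) (hZ : Convex ℝ Z) {h : E → ℝ}
    (hh : UniformlyConvex (p + 1) μ Z h) (hLip : LipschitzDerivOn p L Z h) (T : ℕ) {z : E}
    (hz : z ∈ Z) : ∃ zout qs, IsEpoch p (2 * L) L Z h T z zout qs := by
  -- Validity sits behind the existential so that `choose` gives a total successor map, which can be
  -- iterated.
  have hex : ∀ (t : ℕ) (s : IterState E), ∃ s', s.Valid Z t →
      IsIteration p (2 * L) L Z h t s s' := by
    intro t s
    by_cases hs : s.Valid Z t
    · obtain ⟨s', hs'⟩ := exists_isIteration hp hL hZc hZ hLip hs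
      exact ⟨s', fun _ => hs'⟩
    · exact ⟨s, fun h => absurd h hs⟩
  choose next hnext using hex
  let st : ℕ → IterState E := fun t => Nat.rec (IterState.init z) (fun t s => next t s) t
  have hvalid : ∀ t, (st t).Valid Z t := by
    intro t
    induction t with
    | zero => exact IterState.valid_init hz
    | succ t ih => exact ((hnext t _ ih).valid hp hL hμ hZ hh hLip ih).1
  have hargmin : ∀ f : ℕ → ℝ, ∃ i ≤ T, ∀ t ≤ T, f i ≤ f t := by
    intro f
    obtain ⟨i, hi, hmin⟩ := Finset.exists_min_image (Finset.range (T + 1)) f ⟨0, by simp⟩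
    exact ⟨i, by simpa [Nat.lt_succ_iff] using hi,
      fun t ht => hmin t (by simpa [Nat.lt_succ_iff] using ht)⟩
  obtain ⟨i, hi, hmini⟩ := hargmin fun t => h (st t).z
  obtain ⟨j, hj, hminj⟩ := hargmin fun t => h (st t).zt
  exact ⟨_, _, st, rfl, fun t _ => hnext t _ (hvalid t), ⟨i, hi, j, hj, hmini, hminj, rfl⟩, rfl⟩

theorem exists_isRestartRun [ProperSpace E] {p : ℕ} (hp : 1 ≤ p) {L μ : ℝ} (hL : 0 < L)
    (hμ : 0 ≤ μ) {Z : Set E} (hZc : IsClosed Z) (hZ : Convex ℝ Z) {h : E → ℝ}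
    (hh : UniformlyConvex (p + 1) μ Z h) (hLip : LipschitzDerivOn p L Z h) (T S : ℕ) {z0 : E}
    (hz0 : z0 ∈ Z) : ∃ zout N, IsRestartRun p (2 * L) L Z h T S z0 zout N := by
  have hex : ∀ z : E, ∃ zout qs, z ∈ Z → IsEpoch p (2 * L) L Z h T z zout qs := by
    intro z
    by_cases hz : z ∈ Z
    · obtain ⟨zout, qs, hep⟩ := exists_isEpoch hp hL hμ hZc hZ hh hLip T hz
      exact ⟨zout, qs, fun _ => hep⟩
    · exact ⟨z, [], fun h => absurd h hz⟩
  choose next qs hnext using hex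
  let zs : ℕ → E := fun s => next^[s] z0
  have hsucc : ∀ s, zs (s + 1) = next (zs s) := fun s => Function.iterate_succ_apply' next s z0
  have hmem : ∀ s, zs s ∈ Z := by
    intro s
    induction s with
    | zero => exact hz0
    | succ s ih =>
      rw [hsucc]
      exact ((hnext _ ih).mem_and_le hp hL hμ hZ hh hLip ih).1
  exact ⟨_, _, zs, fun s => qs (zs s), rfl, fun s _ => hsucc s ▸ hnext _ (hmem s), rfl, rfl⟩

theorem IsRestartRun.mem_and_le {p : ℕ} (hp : 1 ≤ p) {L μ : ℝ} (hL : 0 < L) (hμ : 0 < μ)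
    {Z : Set E} (hZ : Convex ℝ Z) {h : E → ℝ} (hh : UniformlyConvex (p + 1) μ Z h)
    (hLip : LipschitzDerivOn p L Z h) {zstar : E} (hstar : zstar ∈ Z) (hmin : IsMinOn h Z zstar)
    {T S N : ℕ} (hT : epochConstant p * (L / μ) ^ ((2 : ℝ) / (3 * p + 1)) ≤ T) {z0 zout : E}
    (hz0 : z0 ∈ Z) (hrun : IsRestartRun p (2 * L) L Z h T S z0 zout N) :
    zout ∈ Z ∧ h zout - h zstar ≤ (1 / 2) ^ S * (h z0 - h zstar) ∧ N ≤ S * (4 * T + 2) := by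
  obtain ⟨zs, qs, h0, hep, rfl, rfl⟩ := hrun
  have key : ∀ s ≤ S, zs s ∈ Z ∧ h (zs s) - h zstar ≤ (1 / 2) ^ s * (h z0 - h zstar) := by
    intro s hs
    induction s with
    | zero =>
      rw [h0]
      exact ⟨hz0, by simp⟩
    | succ s ih =>
      obtain ⟨h1, h2⟩ := ih (by omega)
      have h3 := hep s (by omega)
      refine ⟨(h3.mem_and_le hp hL hμ.le hZ hh hLip h1).1, ?_⟩
      have h4 := h3.sub_le_half hp hL hμ hZ hh hLip hstar hmin hT h1
      rw [pow_succ]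
      linarith
  refine ⟨(key S le_rfl).1, (key S le_rfl).2, ?_⟩
  have h1 := Finset.sum_le_card_nsmul (Finset.range S) (fun s => (qs s).length) (4 * T + 2)
    fun s hs => by
      have hs' := Finset.mem_range.1 hs
      exact ((hep s hs').mem_and_le hp hL hμ.le hZ hh hLip (key s hs'.le).1).2.1
  simpa using h1

end Epoch

/-! ### The number of epochs and the total count of oracle calls. -/

theorem half_pow_ceil_logb_mul_le {Δ ε : ℝ} (hΔ : 0 ≤ Δ) (hε : 0 < ε) :
    (1 / 2 : ℝ) ^ ⌈Real.logb 2 (Δ / ε)⌉₊ * Δ ≤ ε := by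
  rcases hΔ.eq_or_lt with rfl | hΔ
  · simpa using hε.le
  have h1 : Real.logb 2 (Δ / ε) ≤ ⌈Real.logb 2 (Δ / ε)⌉₊ := Nat.le_ceil _
  have h2 := (Real.logb_le_iff_le_rpow (by norm_num) (div_pos hΔ hε)).1 h1
  rw [Real.rpow_natCast, div_le_iff₀ hε] at h2
  rw [one_div, inv_pow, inv_mul_le_iff₀ (by positivity)]
  exact h2

/-- Since `log 2 > 1/2`, passing to the natural logarithm costs a factor `2`, and rounding up adds
at most `1`. -/
theorem ceil_logb_le (x : ℝ) : (⌈Real.logb 2 x⌉₊ : ℝ) ≤ 3 * max 1 (Real.log x) := by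
  have hm : (1 : ℝ) ≤ max 1 (Real.log x) := le_max_left _ _
  rcases le_or_gt (Real.logb 2 x) 0 with h | h
  · rw [Nat.ceil_eq_zero.2 h]
    push_cast
    linarith
  · have h1 := (Nat.ceil_lt_add_one h.le).le
    have h2 : (1 / 2 : ℝ) < Real.log 2 := by
      have := Real.log_two_gt_d9
      linarith
    have h3 : Real.logb 2 x ≤ 2 * max 1 (Real.log x) := by
      rw [Real.logb, div_le_iff₀ (by linarith)]
      calc Real.log x ≤ max 1 (Real.log x) := le_max_right _ _
        _ = 2 * max 1 (Real.log x) * (1 / 2) := by ring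
        _ ≤ _ := by gcongr
    linarith

theorem mainTheorem5 (p : ℕ) (hp : 1 ≤ p) :
    ∃ c C : ℝ, 0 < c ∧ 0 < C ∧
      ∀ (d : ℕ) (Z : Set (EuclideanSpace ℝ (Fin d))) (h : EuclideanSpace ℝ (Fin d) → ℝ)
        (μ L ε : ℝ) (z0 zstar : EuclideanSpace ℝ (Fin d)) (T S : ℕ),
        IsClosed Z → Convex ℝ Z →
        0 < μ → 0 < L → 0 < ε →
        UniformlyConvex (p + 1) μ Z h →
        LipschitzDerivOn p L Z h →
        z0 ∈ Z → zstar ∈ Z → IsMinOn h Z zstar →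
        T = ⌈c * (L / μ) ^ ((2 : ℝ) / (3 * p + 1))⌉₊ →
        S = ⌈Real.logb 2 ((h z0 - h zstar) / ε)⌉₊ →
        (∃ zout N, IsRestartRun p (2 * L) L Z h T S z0 zout N) ∧
        ∀ zout N, IsRestartRun p (2 * L) L Z h T S z0 zout N →
          zout ∈ Z ∧ h zout - h zstar ≤ ε ∧
          (N : ℝ) ≤ C * max 1 ((L / μ) ^ ((2 : ℝ) / (3 * p + 1))) *
            max 1 (Real.log ((h z0 - h zstar) / ε)) := by
  have hc := epochConstant_pos p
  -- The factor `18 = 3 * 6` combines the bound on `S` with `4 * T + 2 ≤ 6 * T`, valid because `T ≥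
  -- 1`.
  refine ⟨epochConstant p, 18 * (epochConstant p + 1), hc, by positivity, ?_⟩
  intro d Z h μ L ε z0 zstar T S hZc hZ hμ hL hε hh hLip hz0 hstar hmin hT hS
  refine ⟨exists_isRestartRun hp hL hμ.le hZc hZ hh hLip T S hz0, fun zout N hrun => ?_⟩
  set x := (L / μ) ^ ((2 : ℝ) / (3 * p + 1)) with hx
  have hx0 : 0 < x := Real.rpow_pos_of_pos (div_pos hL hμ) _
  have hTge : epochConstant p * x ≤ T := hT ▸ Nat.le_ceil _
  obtain ⟨hmem, hle, hN⟩ := hrun.mem_and_le hp hL hμ hZ hh hLip hstar hmin hTge hz0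
  have hgap : 0 ≤ h z0 - h zstar := sub_nonneg.2 (hmin hz0)
  refine ⟨hmem, hle.trans (hS ▸ half_pow_ceil_logb_mul_le hgap hε), ?_⟩
  have hT1 : (1 : ℝ) ≤ T := by
    have : 0 < (T : ℝ) := lt_of_lt_of_le (by positivity) hTge
    exact_mod_cast this
  have hTle : (T : ℝ) ≤ (epochConstant p + 1) * max 1 x := by
    have h1 : (T : ℝ) ≤ epochConstant p * x + 1 := hT ▸ (Nat.ceil_lt_add_one (by positivity)).le
    have h2 : epochConstant p * x ≤ epochConstant p * max 1 x := by
      gcongr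
      exact le_max_right _ _
    have h3 : (1 : ℝ) ≤ max 1 x := le_max_left _ _
    linarith
  have hSle : (S : ℝ) ≤ 3 * max 1 (Real.log ((h z0 - h zstar) / ε)) := hS ▸ ceil_logb_le _
  calc (N : ℝ) ≤ S * (4 * T + 2) := by exact_mod_cast hN
    _ ≤ S * (6 * T) := by gcongr; linarith
    _ ≤ (3 * max 1 (Real.log ((h z0 - h zstar) / ε))) *
        (6 * ((epochConstant p + 1) * max 1 x)) := by gcongr
    _ = _ := by ring
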